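/- Let $V$ be a Euclidean space of dimension $n\ge 3$ and let $1\le k\le n-2$. Let $G_k(V)$ be the compact real analytic manifold of pairs $(E,l)$, where $E\subset V$ is a $k$-dimensional linear subspace and $l\subset V$ is a line orthogonal to $E$. For a continuous function $f\colon G_k(V)\to\mathbb{C}$ and a non-empty convex compact polytope $P\subset V$ put $$\phi_f(P)=\sum_{F}\mathrm{vol}_k(F)\int_{\gamma_F} f(\bar F,\mathbb{R}u)\,du ,$$ where $F$ runs over the $k$-dimensional faces of $P$ ($P$ itself included if $\dim P=k$), $\bar F$ is the linear subspace parallel to $F$, $\gamma_F$ is the set of unit vectors $u\in\bar F^\perp$ such that $\langle u,p-x\rangle\le 0$ for all $p\in P$ and some (equivalently, any) $x$ in the relative interior of $F$, and $du$ is the rotation invariant measure of total mass $1$ on the unit sphere of $\bar F^\perp$. Then there is a function $f\colon G_k(V)\to\mathbb{C}$ that is real analytic and, moreover, $O(n)$-finite (that is, contained in a finite dimensional $O(n)$-invariant linear subspace of the continuous complex-valued functions on $G_k(V)$), such that the functional $\phi_f$ on polytopes has no extension to the family $\mathcal{K}(V)$ of all non-empty convex compact subsets of $V$ that is continuous in the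 Hausdorff metric. -/

import Mathlib

open MeasureTheory Topology

noncomputable section

section Flags

variable (V : Type*) [NormedAddCommGroup V] [InnerProductSpace ℝ V] (k : ℕ)

/-- The set `G_k(V)` of pairs `(E, l)`, where `E` is a `k`-dimensional linear subspace of the
Euclidean space `V` and `l` is a line in `V` orthogonal to `E`. -/
@[ext]
structure OrthFlag where
  /-- the `k`-dimensional subspace `E` -/
  space : Submodule ℝ V
  /-- the line `l` -/
  line : Submodule ℝ V
  finrank_space : Module.finrank ℝ space = k
  finrank_line : Module.finrank ℝ line = 1
  orthogonal : space ⟂ line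

end Flags

namespace OrthFlag

variable {V : Type*} [NormedAddCommGroup V] [InnerProductSpace ℝ V] {k : ℕ}

/-- The pair `(E, ℝ u)` for a unit vector `u` of `Eᗮ`. -/
def ofUnit (E : Submodule ℝ V) (hE : Module.finrank ℝ E = k)
    (u : Metric.sphere (0 : Eᗮ) 1) : OrthFlag V k where
  space := E
  line := Submodule.span ℝ {((u : Eᗮ) : V)}
  finrank_space := hE
  finrank_line := by
    refine finrank_span_singleton ?_
    have h : (u : Eᗮ) ≠ 0 := ne_zero_of_mem_unit_sphere u
    simpa using h
  orthogonal := by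
    have hspan : Submodule.span ℝ {((u : Eᗮ) : V)} ≤ Eᗮ :=
      (Submodule.span_singleton_le_iff_mem _ _).2 (u : Eᗮ).2
    exact (Submodule.isOrtho_orthogonal_right E).mono_right hspan

/-- The action of the orthogonal group `O(V)` on `G_k(V)`: `g (E, l) = (g E, g l)`. -/
def map (g : V ≃ₗᵢ[ℝ] V) (p : OrthFlag V k) : OrthFlag V k where
  space := p.space.map (g.toLinearEquiv : V →ₗ[ℝ] V)
  line := p.line.map (g.toLinearEquiv : V →ₗ[ℝ] V)
  finrank_space := (LinearEquiv.finrank_map_eq g.toLinearEquiv p.space).trans p.finrank_space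
  finrank_line := (LinearEquiv.finrank_map_eq g.toLinearEquiv p.line).trans p.finrank_line
  orthogonal := p.orthogonal.map g.toLinearIsometry

variable [FiniteDimensional ℝ V]

/-- The standard embedding of the compact manifold `G_k(V)` into a vector space: `(E, l)` goes to
the pair of orthogonal projections of `V` onto `E` and onto `l`. Its image is an orbit of `O(V)`,
acting by simultaneous conjugation, hence a compact real analytic submanifold. -/
def embed (p : OrthFlag V k) : (V →L[ℝ] V) × (V →L[ℝ] V) :=
  (p.space.starProjection, p.line.starProjection)

theorem embed_injective : Function.Injective (embed : OrthFlag V k → _) := by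
  intro p q h
  have h1 : p.space.starProjection = q.space.starProjection := congrArg Prod.fst h
  have h2 : p.line.starProjection = q.line.starProjection := congrArg Prod.snd h
  exact OrthFlag.ext (Submodule.starProjection_inj.1 h1) (Submodule.starProjection_inj.1 h2)

/-- The topology of `G_k(V)`, as a submanifold of the space of pairs of operators. -/
instance : TopologicalSpace (OrthFlag V k) := TopologicalSpace.induced embed inferInstance

/-- A complex-valued function on `G_k(V)` is real analytic if, near every point, it is the
restriction of a real analytic function of the ambient space to the submanifold `G_k(V)`. -/
def IsRealAnalytic (f : OrthFlag V k → ℂ) : Prop :=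
  ∀ p : OrthFlag V k, ∃ g : (V →L[ℝ] V) × (V →L[ℝ] V) → ℂ,
    AnalyticAt ℝ g p.embed ∧ ∀ᶠ q in 𝓝 p, f q = g q.embed

/-- A function on `G_k(V)` is `O(n)`-finite if it belongs to a finite dimensional `O(V)`-invariant
linear subspace `W` of the space of continuous complex-valued functions on `G_k(V)`. -/
def IsOrthogonallyFinite (f : OrthFlag V k → ℂ) : Prop :=
  ∃ W : Submodule ℂ (OrthFlag V k → ℂ), FiniteDimensional ℂ W ∧ (∀ h ∈ W, Continuous h) ∧
    (∀ g : V ≃ₗᵢ[ℝ] V, ∀ h ∈ W, (fun p => h (p.map g)) ∈ W) ∧ f ∈ W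

end OrthFlag

section Polytopes

variable {V : Type*} [NormedAddCommGroup V] [InnerProductSpace ℝ V]

/-- A convex body (nonempty compact convex set) is a polytope if it is the convex hull of finitely
many points. -/
def ConvexBody.IsPolytope (P : ConvexBody V) : Prop :=
  ∃ s : Finset V, (P : Set V) = convexHull ℝ (s : Set V)

/-- The set of `k`-dimensional faces of `P`. The faces of a polytope are the nonempty sets of
maximum points on `P` of linear functionals; `P` is a face of itself. -/
def kFaces (k : ℕ) (P : ConvexBody V) : Set (Set V) :=
  {F | F.Nonempty ∧ IsExposed ℝ (P : Set V) F ∧ Module.finrank ℝ (vectorSpan ℝ F) = k}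

/-- The exterior angle of `P` at its face `F`, a subset of the unit sphere of the orthogonal
complement of the linear subspace `vectorSpan ℝ F` parallel to `F`. -/
def exteriorAngle (P : ConvexBody V) (F : Set V) :
    Set (Metric.sphere (0 : (vectorSpan ℝ F)ᗮ) 1) :=
  {u | ∃ x ∈ intrinsicInterior ℝ F, ∀ p ∈ P, inner ℝ ((u : (vectorSpan ℝ F)ᗮ) : V) (p - x) ≤ 0}

variable [FiniteDimensional ℝ V] [MeasurableSpace V] [BorelSpace V]

/-- The rotation invariant measure of total mass one on the unit sphere of `E`. -/
def sphereProb (E : Submodule ℝ V) : Measure (Metric.sphere (0 : E) 1) :=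
  ((volume : Measure E).toSphere Set.univ)⁻¹ • (volume : Measure E).toSphere

/-- The Lebesgue measure of `F` within its affine hull. The orthogonal projection to the linear
subspace parallel to `F` is a translation on the affine hull of `F`. -/
def faceVolume (F : Set V) : ℝ :=
  (volume : Measure (vectorSpan ℝ F)).real ((vectorSpan ℝ F).orthogonalProjectionOnto '' F)

/-- The functional `φ_f(P) = ∑_F vol(F) ∫_{γ_F} f(F̄, l) dl`, the sum over the `k`-faces of `P`. -/
def phi {k : ℕ} (f : OrthFlag V k → ℂ) (P : ConvexBody V) : ℂ :=
  ∑ᶠ F : kFaces k P, (faceVolume (F : Set V) : ℂ) *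
    ∫ u in exteriorAngle P (F : Set V), f (OrthFlag.ofUnit (vectorSpan ℝ (F : Set V)) F.2.2.2 u)
      ∂(sphereProb (vectorSpan ℝ (F : Set V))ᗮ)

/-- `φ_f`, regarded as a functional on polytopes, has an extension to all convex bodies that is
continuous in the Hausdorff metric. -/
def PhiExtends {k : ℕ} (f : OrthFlag V k → ℂ) : Prop :=
  ∃ Φ : ConvexBody V → ℂ, Continuous Φ ∧ ∀ P : ConvexBody V, P.IsPolytope → Φ P = phi f P

end Polytopes

end

/-! Two sequences of inscribed polytopes converge to the same convex body while `φ_f` has different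
limits on them.

Write `k = m + 1` and choose orthonormal vectors `v₀, v₁, v₂, b_1, …, b_m`, which is possible
because `m + 3 ≤ n`. Take `f(E, l) = ∏ ⟪b_j, P_E b_j⟫ · ⟪v₁, P_E v₀⟫²`. It is a non-negative
polynomial in the projection `P_E`, hence real analytic and `O(n)`-finite. It detects subspaces that
contain every `b_j` partially and in which `v₀` and `v₁` are mixed.

The polytopes are hulls of lattice points lifted to the paraboloid `z = -(x² + y²)/2` over the unit
square, times the unit cube in the `b_j`. Over the full square grid, a linear functional on the
lifted points is a sum of functions of the separate coordinates. Its maximizers therefore form a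
product, so a `k`-face is orthogonal to `v₀`, to `v₁` or to some `b_j`, and `φ_f` vanishes
(`entryPoly_eq_zero_of_mem_kFaces`).

Over the sublattice with `a + b` even, the edges of the upper hull run diagonally, and `f ≥ 1/9` on
those over direction `(1, 1)`, times the cube. Such edges with equal `a + b` are parallel, and their
exterior angles jointly cover a set of directions of probability bounded below. One row thus
contributes at least a constant times the mesh `h`, and there are about `1/h` rows, so `φ_f` stays
above a positive constant (`le_re_phi_evenGrid`). By `tendsto_latticeBody` both sequences have the
limit `parabBody`, so no continuous extension exists. -/

noncomputable section

namespace OrthFlag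

/-! ### Polynomials in the projection `P_E` are `O(n)`-finite -/

section Polynomials

variable {V : Type*} [NormedAddCommGroup V] [InnerProductSpace ℝ V] [FiniteDimensional ℝ V] {k : ℕ}

/-- The functions on `G_k(V)` that depend linearly on the orthogonal projection to `E`. -/
def linearFormsMap (V : Type*) [NormedAddCommGroup V] [InnerProductSpace ℝ V]
    [FiniteDimensional ℝ V] (k : ℕ) :
    ((V →L[ℝ] V) →ₗ[ℝ] ℂ) →ₗ[ℂ] (OrthFlag V k → ℂ) where
  toFun L p := L p.space.starProjection
  map_add' _ _ := rfl
  map_smul' _ _ := rfl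

/-- Precomposition with the action of an isometry. -/
def pullback (k : ℕ) (g : V ≃ₗᵢ[ℝ] V) : (OrthFlag V k → ℂ) →ₐ[ℂ] (OrthFlag V k → ℂ) where
  toFun h p := h (p.map g)
  map_one' := rfl
  map_mul' _ _ := rfl
  map_zero' := rfl
  map_add' _ _ := rfl
  commutes' _ := rfl

theorem continuous_embed : Continuous (embed : OrthFlag V k → _) :=
  continuous_induced_dom

theorem continuous_of_mem_range_linearFormsMap {h : OrthFlag V k → ℂ}
    (hh : h ∈ LinearMap.range (linearFormsMap V k)) : Continuous h := by
  obtain ⟨L, rfl⟩ := hh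
  exact L.continuous_of_finiteDimensional.comp (continuous_fst.comp continuous_embed)

/-- The projection onto `g E` is the conjugate of `P_E` by `g`, and conjugation is linear. -/
theorem pullback_range_linearFormsMap_le (g : V ≃ₗᵢ[ℝ] V) :
    (LinearMap.range (linearFormsMap V k)).map (pullback k g).toLinearMap ≤
      LinearMap.range (linearFormsMap V k) := by
  rintro _ ⟨_, ⟨L, rfl⟩, rfl⟩
  let c : (V →L[ℝ] V) →ₗ[ℝ] (V →L[ℝ] V) :=
    { toFun := fun S => (g : V →L[ℝ] V) ∘L S ∘L (g.symm : V →L[ℝ] V)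
      map_add' := fun S T => by ext; simp
      map_smul' := fun a S => by ext; simp }
  refine ⟨L ∘ₗ c, funext fun p => ?_⟩
  change L (c p.space.starProjection) = L ((p.map g).space.starProjection)
  congr 1
  ext x
  exact (Submodule.starProjection_map_apply g p.space x).symm

/-- Polynomials in the projection to `E` are `O(n)`-finite. -/
theorem isOrthogonallyFinite_of_mem_pow {f : OrthFlag V k → ℂ} {d : ℕ}
    (hf : f ∈ LinearMap.range (linearFormsMap V k) ^ d) : IsOrthogonallyFinite f := by
  refine ⟨LinearMap.range (linearFormsMap V k) ^ d, ?_, ?_, ?_, hf⟩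
  · exact Module.Finite.iff_fg.2
      ((Module.Finite.iff_fg.1 (inferInstance : Module.Finite ℂ
        (LinearMap.range (linearFormsMap V k)))).pow d)
  · intro h hh
    refine Submodule.pow_induction_on_left _ (C := fun h : OrthFlag V k → ℂ => Continuous h)
      (fun r => continuous_const) (fun x y hx hy => hx.add hy) (fun m hm x hx => ?_) hh
    exact (continuous_of_mem_range_linearFormsMap hm).mul hx
  · intro g h hh
    have : (LinearMap.range (linearFormsMap V k) ^ d).map (pullback k g).toLinearMap ≤
        LinearMap.range (linearFormsMap V k) ^ d := by
      rw [Submodule.map_pow]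
      exact pow_le_pow_left₀ bot_le (pullback_range_linearFormsMap_le g) d
    exact this ⟨h, hh, rfl⟩

end Polynomials

/-! ### The function `f` -/

section FlagFun

variable {V : Type*} [NormedAddCommGroup V] [InnerProductSpace ℝ V] {k m : ℕ}

/-- The matrix entry `⟪a, S b⟫` as a complex valued linear function of `S`. -/
def entry (a b : V) : (V →L[ℝ] V) →ₗ[ℝ] ℂ :=
  Complex.ofRealCLM.toLinearMap ∘ₗ (innerₛₗ ℝ a) ∘ₗ (ContinuousLinearMap.apply ℝ V b).toLinearMap

theorem entry_apply (a b : V) (S : V →L[ℝ] V) : entry a b S = (inner ℝ a (S b) : ℝ) := rfl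

/-- A polynomial in the matrix entries of `S` with respect to the vectors `v`. -/
def entryPoly (v : Fin 3 ⊕ Fin m → V) (S : V →L[ℝ] V) : ℝ :=
  (∏ j, inner ℝ (v (.inr j)) (S (v (.inr j)))) * (inner ℝ (v (.inl 1)) (S (v (.inl 0)))) ^ 2

variable [FiniteDimensional ℝ V]

/-- The function `(E, l) ↦ ∏ j, ⟪b_j, P_E b_j⟫ * ⟪v₁, P_E v₀⟫ ^ 2`. -/
def flagFun (k : ℕ) (v : Fin 3 ⊕ Fin m → V) (p : OrthFlag V k) : ℂ :=
  (entryPoly v p.space.starProjection : ℂ)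

theorem flagFun_mem_pow (v : Fin 3 ⊕ Fin m → V) :
    flagFun k v ∈ LinearMap.range (linearFormsMap V k) ^ (m + 2) := by
  have h : flagFun k v = (∏ j, linearFormsMap V k (entry (v (.inr j)) (v (.inr j)))) *
      (linearFormsMap V k (entry (v (.inl 1)) (v (.inl 0)))) ^ 2 := by
    ext p
    simp only [flagFun, entryPoly, Pi.mul_apply, Finset.prod_apply, Pi.pow_apply, linearFormsMap,
      LinearMap.coe_mk, AddHom.coe_mk, entry_apply]
    push_cast
    rfl
  rw [h, pow_add]
  refine Submodule.mul_mem_mul ?_ (Submodule.pow_mem_pow _ (LinearMap.mem_range_self _ _) 2)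
  have : ∀ s : Finset (Fin m), (∏ j ∈ s, linearFormsMap V k (entry (v (.inr j)) (v (.inr j)))) ∈
      LinearMap.range (linearFormsMap V k) ^ s.card := by
    intro s
    induction s using Finset.induction_on with
    | empty => simp [Submodule.one_le.1 le_rfl]
    | insert a s ha ih =>
      rw [Finset.prod_insert ha, Finset.card_insert_of_notMem ha, pow_succ']
      exact Submodule.mul_mem_mul ⟨_, rfl⟩ ih
  simpa using this Finset.univ

theorem isRealAnalytic_flagFun (v : Fin 3 ⊕ Fin m → V) : IsRealAnalytic (flagFun k v) := by
  intro p
  refine ⟨fun q => (entryPoly v q.1 : ℂ), ?_, Filter.Eventually.of_forall fun q => rfl⟩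
  have hentry : ∀ a b : V, AnalyticAt ℝ
      (fun q : (V →L[ℝ] V) × (V →L[ℝ] V) => (inner ℝ a (q.1 b) : ℝ)) p.embed := by
    intro a b
    exact ((innerSL ℝ a) ∘L (ContinuousLinearMap.apply ℝ V b) ∘L
      (ContinuousLinearMap.fst ℝ (V →L[ℝ] V) (V →L[ℝ] V))).analyticAt _
  have h : AnalyticAt ℝ (fun q : (V →L[ℝ] V) × (V →L[ℝ] V) => entryPoly v q.1) p.embed := by
    unfold entryPoly
    exact (Finset.analyticAt_fun_prod _ fun j _ => hentry _ _).mul ((hentry _ _).pow 2)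
  exact (Complex.ofRealCLM.analyticAt _).comp h

/-- Since `⟪b, P b⟫ = ‖P b‖²` and the last factor is a square, no cancellation between faces can
occur, and any subfamily of faces bounds `φ_f` from below. -/
theorem entryPoly_starProjection_nonneg (v : Fin 3 ⊕ Fin m → V) (E : Submodule ℝ V) :
    0 ≤ entryPoly v E.starProjection := by
  refine mul_nonneg (Finset.prod_nonneg fun j _ => ?_) (sq_nonneg _)
  rw [real_inner_comm]
  have := E.inner_starProjection_left_eq_right (E.starProjection (v (.inr j))) (v (.inr j))
  rw [Submodule.starProjection_eq_self_iff.2 (E.starProjection_apply_mem _)] at this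
  rw [this]
  exact real_inner_self_nonneg

end FlagFun

end OrthFlag

end

noncomputable section

/-! ### Exposed faces of a convex hull of finitely many points -/

section Faces

variable {V : Type*} [NormedAddCommGroup V] [InnerProductSpace ℝ V]

/-- Krein–Milman: extreme points of an exposed face are extreme in the whole hull, hence belong to
`s`. -/
theorem IsExposed.eq_convexHull_inter [FiniteDimensional ℝ V] {s F : Set V} (hs : s.Finite)
    (hF : IsExposed ℝ (convexHull ℝ s) F) : F = convexHull ℝ (s ∩ F) := by
  have hc : IsCompact F := hF.isCompact (hs.isCompact_convexHull (𝕜 := ℝ))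
  have hconv : Convex ℝ F := hF.convex (convex_convexHull ℝ s)
  refine subset_antisymm ?_ (convexHull_min Set.inter_subset_right hconv)
  have hfin : (s ∩ F).Finite := hs.subset Set.inter_subset_left
  have hsub : F.extremePoints ℝ ⊆ s ∩ F := by
    rw [hF.isExtreme.extremePoints_eq]
    exact fun x hx => ⟨extremePoints_convexHull_subset hx.2, hx.1⟩
  calc F = closure (convexHull ℝ (F.extremePoints ℝ)) :=
        (closure_convexHull_extremePoints hc hconv).symm
    _ ⊆ closure (convexHull ℝ (s ∩ F)) := closure_mono (convexHull_mono hsub)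
    _ = convexHull ℝ (s ∩ F) := (hfin.isClosed_convexHull (𝕜 := ℝ)).closure_eq

theorem ConvexBody.IsPolytope.finite_kFaces [FiniteDimensional ℝ V] {P : ConvexBody V}
    (hP : P.IsPolytope) (k : ℕ) : (kFaces k P).Finite := by
  obtain ⟨s, hs⟩ := hP
  refine Set.Finite.subset ((s.finite_toSet.finite_subsets).image (convexHull ℝ)) ?_
  rintro F ⟨-, hF, -⟩
  rw [hs] at hF
  exact ⟨_, Set.inter_subset_left, (hF.eq_convexHull_inter s.finite_toSet).symm⟩

theorem vectorSpan_convexHull (s : Set V) : vectorSpan ℝ (convexHull ℝ s) = vectorSpan ℝ s := by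
  rw [← direction_affineSpan, affineSpan_convexHull, direction_affineSpan]

/-- The hull of the points of `s` at which a linear functional is maximal is an exposed face. -/
theorem isExposed_convexHull_of_maximizers [FiniteDimensional ℝ V] {s t : Set V} (hs : s.Finite)
    (hts : t ⊆ s) (l : V →L[ℝ] ℝ) (c : ℝ) (hle : ∀ x ∈ s, l x ≤ c) (ht : ∀ x ∈ s, l x = c ↔ x ∈ t) (hne : t.Nonempty) :
    IsExposed ℝ (convexHull ℝ s) (convexHull ℝ t) := by
  have hmax : ∀ y ∈ convexHull ℝ s, l y ≤ c := fun y hy =>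
    convexHull_min (t := {y | l y ≤ c}) hle (convex_halfSpace_le l.isLinear c) hy
  obtain ⟨x₀, hx₀⟩ := hne
  have h0 : l x₀ = c := (ht x₀ (hts hx₀)).2 hx₀
  have hexp : IsExposed ℝ (convexHull ℝ s) (l.toExposed (convexHull ℝ s)) :=
    ContinuousLinearMap.toExposed.isExposed
  have hmem : ∀ x, x ∈ l.toExposed (convexHull ℝ s) ↔ x ∈ convexHull ℝ s ∧ l x = c := by
    intro x
    refine ⟨fun hx => ⟨hx.1, le_antisymm (hmax x hx.1) ?_⟩, fun hx => ⟨hx.1, fun y hy => ?_⟩⟩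
    · rw [← h0]
      exact hx.2 _ (subset_convexHull ℝ s (hts hx₀))
    · rw [hx.2]; exact hmax y hy
  have hst : s ∩ l.toExposed (convexHull ℝ s) = t := by
    ext x
    rw [Set.mem_inter_iff, hmem]
    exact ⟨fun h => (ht x h.1).1 h.2.2, fun h => ⟨hts h, subset_convexHull ℝ s (hts h),
      (ht x (hts h)).2 h⟩⟩
  rwa [hexp.eq_convexHull_inter hs, hst] at hexp

end Faces

/-! ### Evaluating and bounding `φ_f` -/

section Phi

variable {V : Type*} [NormedAddCommGroup V] [InnerProductSpace ℝ V] [FiniteDimensional ℝ V]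
  [MeasurableSpace V] [BorelSpace V] {k m : ℕ}

/-- The summand of `φ_f(P)` at the face `F`, for `f = flagFun k v`. -/
def phiTerm (v : Fin 3 ⊕ Fin m → V) (P : ConvexBody V) (F : Set V) : ℝ :=
  faceVolume F * ((sphereProb (vectorSpan ℝ F)ᗮ).real (exteriorAngle P F) *
    OrthFlag.entryPoly v (vectorSpan ℝ F).starProjection)

theorem phiTerm_nonneg (v : Fin 3 ⊕ Fin m → V) (P : ConvexBody V) (F : Set V) :
    0 ≤ phiTerm v P F :=
  mul_nonneg measureReal_nonneg (mul_nonneg measureReal_nonneg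
    (OrthFlag.entryPoly_starProjection_nonneg v _))

/-- The function does not depend on the line `l`, so each integral is the exterior angle times a
constant. -/
theorem phi_flagFun (v : Fin 3 ⊕ Fin m → V) (P : ConvexBody V) :
    phi (OrthFlag.flagFun k v) P = ∑ᶠ F : kFaces k P, (phiTerm v P F : ℂ) := by
  unfold phi
  congr 1 with F
  have : ∀ u, OrthFlag.flagFun k v (OrthFlag.ofUnit (vectorSpan ℝ (F : Set V)) F.2.2.2 u) =
    (OrthFlag.entryPoly v (vectorSpan ℝ (F : Set V)).starProjection : ℂ) := fun u => rfl
  simp only [this, setIntegral_const, phiTerm]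
  push_cast
  simp

theorem phi_flagFun_eq_zero (v : Fin 3 ⊕ Fin m → V) (P : ConvexBody V)
    (h : ∀ F ∈ kFaces k P, OrthFlag.entryPoly v (vectorSpan ℝ F).starProjection = 0) :
    phi (OrthFlag.flagFun k v) P = 0 := by
  rw [phi_flagFun]
  refine finsum_eq_zero_of_forall_eq_zero fun F => ?_
  simp [phiTerm, h F F.2]

theorem sum_phiTerm_le_re_phi (v : Fin 3 ⊕ Fin m → V) {P : ConvexBody V} (hP : P.IsPolytope)
    {ι : Type*} (I : Finset ι) (F : ι → Set V) (hF : ∀ i ∈ I, F i ∈ kFaces k P)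
    (hinj : Set.InjOn F I) :
    ∑ i ∈ I, phiTerm v P (F i) ≤ (phi (OrthFlag.flagFun k v) P).re := by
  classical
  rw [phi_flagFun, finsum_set_coe_eq_finsum_mem (f := fun F => ((phiTerm v P F : ℝ) : ℂ))
    (kFaces k P),
    finsum_mem_eq_finite_toFinset_sum _ (hP.finite_kFaces k), ← Complex.ofReal_sum,
    Complex.ofReal_re, ← Finset.sum_image hinj]
  refine Finset.sum_le_sum_of_subset_of_nonneg ?_ fun F _ _ => phiTerm_nonneg v P F
  intro G hG
  obtain ⟨i, hi, rfl⟩ := Finset.mem_image.1 hG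
  simpa using hF i hi

end Phi

end

noncomputable section

/-! ### Lifted lattice polytopes; vanishing over product grids -/

section Paraboloid

variable {V : Type*} [NormedAddCommGroup V] [InnerProductSpace ℝ V] {m : ℕ}

/-- The coordinates of a vertex of the unit cube. -/
def bits (w : Fin m → Bool) (j : Fin m) : ℝ := if w j then 1 else 0

/-- The point over `(x, y)` of a paraboloid, translated by `∑ j, t j • b_j`. -/
def parabPoint (v : Fin 3 ⊕ Fin m → V) (x y : ℝ) (t : Fin m → ℝ) : V :=
  x • v (.inl 0) + y • v (.inl 1) - ((x ^ 2 + y ^ 2) / 2) • v (.inl 2) + ∑ j, t j • v (.inr j)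

theorem map_parabPoint (v : Fin 3 ⊕ Fin m → V) (l : V →ₗ[ℝ] ℝ) (x y : ℝ) (t : Fin m → ℝ) :
    l (parabPoint v x y t) = x * l (v (.inl 0)) + y * l (v (.inl 1)) -
      (x ^ 2 + y ^ 2) / 2 * l (v (.inl 2)) + ∑ j, t j * l (v (.inr j)) := by
  simp [parabPoint]

theorem inner_parabPoint (v : Fin 3 ⊕ Fin m → V) (u : V) (x y : ℝ) (t : Fin m → ℝ) :
    inner ℝ u (parabPoint v x y t) = x * inner ℝ u (v (.inl 0)) + y * inner ℝ u (v (.inl 1)) -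
      (x ^ 2 + y ^ 2) / 2 * inner ℝ u (v (.inl 2)) + ∑ j, t j * inner ℝ u (v (.inr j)) :=
  map_parabPoint v (innerₛₗ ℝ u) x y t

section Coordinates

variable {v : Fin 3 ⊕ Fin m → V} (hv : Orthonormal ℝ v)
include hv

theorem inner_frame (i j : Fin 3 ⊕ Fin m) : inner ℝ (v i) (v j) = if i = j then 1 else 0 :=
  orthonormal_iff_ite.1 hv i j

theorem inner_zero_parabPoint (x y : ℝ) (t : Fin m → ℝ) :
    inner ℝ (v (.inl 0)) (parabPoint v x y t) = x := by
  simp [inner_parabPoint, inner_frame hv, hv.1]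

theorem inner_one_parabPoint (x y : ℝ) (t : Fin m → ℝ) :
    inner ℝ (v (.inl 1)) (parabPoint v x y t) = y := by
  simp [inner_parabPoint, inner_frame hv, hv.1]

theorem inner_inr_parabPoint (x y : ℝ) (t : Fin m → ℝ) (j : Fin m) :
    inner ℝ (v (.inr j)) (parabPoint v x y t) = t j := by
  simp [inner_parabPoint, inner_frame hv]

end Coordinates

theorem parabPoint_update (v : Fin 3 ⊕ Fin m → V) (x y : ℝ) (w : Fin m → Bool) (j : Fin m) :
    parabPoint v x y (bits (Function.update w j true)) -
      parabPoint v x y (bits (Function.update w j false)) = v (.inr j) := by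
  have h : ∀ i, bits (Function.update w j true) i • v (.inr i) -
      bits (Function.update w j false) i • v (.inr i) = if i = j then v (.inr i) else 0 := by
    intro i
    by_cases hij : i = j
    · subst hij; simp [bits]
    · simp [bits, hij]
  rw [parabPoint, parabPoint, add_sub_add_left_eq_sub, ← Finset.sum_sub_distrib]
  simp [h]

/-- The vertices `(a h, b h)`, `(a, b) ∈ D`, lifted to the paraboloid, times those of the cube. -/
def liftedLattice (v : Fin 3 ⊕ Fin m → V) (h : ℝ) (D : Set (ℕ × ℕ)) : Set V :=
  (fun q : (ℕ × ℕ) × (Fin m → Bool) => parabPoint v (q.1.1 * h) (q.1.2 * h) (bits q.2)) ''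
    (D ×ˢ Set.univ)

theorem finite_liftedLattice (v : Fin 3 ⊕ Fin m → V) (h : ℝ) {D : Set (ℕ × ℕ)} (hD : D.Finite) :
    (liftedLattice v h D).Finite :=
  (hD.prod Set.finite_univ).image _

theorem parabPoint_mem_liftedLattice (v : Fin 3 ⊕ Fin m → V) (h : ℝ) {D : Set (ℕ × ℕ)} {a b : ℕ}
    (hab : (a, b) ∈ D) (w : Fin m → Bool) :
    parabPoint v (a * h) (b * h) (bits w) ∈ liftedLattice v h D :=
  ⟨((a, b), w), ⟨hab, Set.mem_univ _⟩, rfl⟩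

/-- The convex hull of the lifted lattice points. -/
def latticeBody [FiniteDimensional ℝ V] (v : Fin 3 ⊕ Fin m → V) (h : ℝ) (D : Set (ℕ × ℕ))
    (hD : D.Finite) (hne : D.Nonempty) : ConvexBody V where
  carrier := convexHull ℝ (liftedLattice v h D)
  convex' := convex_convexHull ℝ _
  isCompact' := (finite_liftedLattice v h hD).isCompact_convexHull (𝕜 := ℝ)
  nonempty' := by
    obtain ⟨⟨a, b⟩, hab⟩ := hne
    exact ⟨_, subset_convexHull ℝ _ (parabPoint_mem_liftedLattice v h hab fun _ => true)⟩

theorem isPolytope_latticeBody [FiniteDimensional ℝ V] (v : Fin 3 ⊕ Fin m → V) (h : ℝ)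
    {D : Set (ℕ × ℕ)} (hD : D.Finite) (hne : D.Nonempty) :
    (latticeBody v h D hD hne).IsPolytope :=
  ⟨(finite_liftedLattice v h hD).toFinset, by rw [Set.Finite.coe_toFinset]; rfl⟩

theorem vectorSpan_le_orthogonal_of_const {M : Set V} (a : V)
    (h : ∀ p ∈ M, ∀ q ∈ M, inner ℝ a p = (inner ℝ a q : ℝ)) :
    ∀ e ∈ vectorSpan ℝ M, inner ℝ a e = (0 : ℝ) := by
  intro e he
  have hle : vectorSpan ℝ M ≤ (innerₛₗ ℝ a).ker := by
    refine Submodule.span_le.2 ?_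
    rintro _ ⟨p, hp, q, hq, rfl⟩
    have := h p hp q hq
    simp [inner_sub_right, this]
  exact hle he

/-- On a product grid, the `(m+1)`-faces are orthogonal to one of the coordinate directions. -/
theorem entryPoly_eq_zero_of_mem_kFaces [FiniteDimensional ℝ V] {v : Fin 3 ⊕ Fin m → V}
    (hv : Orthonormal ℝ v) (h : ℝ) {A B : Set ℕ} (hA : (A ×ˢ B).Finite)
    (hne : (A ×ˢ B).Nonempty) {F : Set V}
    (hF : F ∈ kFaces (m + 1) (latticeBody v h (A ×ˢ B) hA hne)) :
    OrthFlag.entryPoly v (vectorSpan ℝ F).starProjection = 0 := by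
  obtain ⟨hFne, hexp, hdim⟩ := hF
  have hexp : IsExposed ℝ (convexHull ℝ (liftedLattice v h (A ×ˢ B))) F := hexp
  have hhull := hexp.eq_convexHull_inter (finite_liftedLattice v h hA)
  set M := liftedLattice v h (A ×ˢ B) ∩ F with hM
  have hspan : vectorSpan ℝ F = vectorSpan ℝ M := by rw [hhull, vectorSpan_convexHull]
  have hMne : M.Nonempty := by
    rw [hhull] at hFne; exact convexHull_nonempty_iff.1 hFne
  obtain ⟨l, hl⟩ := hexp hFne
  have hmax : ∀ p ∈ M, ∀ q ∈ liftedLattice v h (A ×ˢ B), l q ≤ l p := by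
    intro p hp q hq
    have := hp.2
    rw [hl] at this
    exact this.2 q (subset_convexHull ℝ _ hq)
  have hmem : ∀ p ∈ M, ∀ q ∈ liftedLattice v h (A ×ˢ B), l p ≤ l q → q ∈ M := by
    intro p hp q hq hpq
    refine ⟨hq, ?_⟩
    have := hp.2
    rw [hl] at this ⊢
    exact ⟨subset_convexHull ℝ _ hq, fun y hy => (this.2 y hy).trans hpq⟩
  have hE : ∀ p ∈ M, ∀ q ∈ M, p - q ∈ vectorSpan ℝ F := fun p hp q hq => by
    rw [hspan]; exact vsub_mem_vectorSpan ℝ hp hq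
  have hproj : ∀ a, (vectorSpan ℝ F).starProjection a ∈ vectorSpan ℝ F := fun a =>
    Submodule.starProjection_apply_mem _ a
  have horth : ∀ a : V, (∀ p ∈ M, ∀ q ∈ M, inner ℝ a p = (inner ℝ a q : ℝ)) →
      ∀ e ∈ vectorSpan ℝ F, inner ℝ a e = (0 : ℝ) := by
    rw [hspan]; exact fun a => vectorSpan_le_orthogonal_of_const a
  by_contra hne0
  obtain ⟨hprod, hsq⟩ := mul_ne_zero_iff.1 hne0
  have hXY : inner ℝ (v (.inl 1)) ((vectorSpan ℝ F).starProjection (v (.inl 0))) ≠ (0 : ℝ) :=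
    fun h0 => hsq (by rw [h0]; norm_num)
  -- If `l` vanishes on `b_j`, flipping the `j`-th bit stays in the face. Otherwise all maximizing
  -- vertices have the same `j`-th bit, so `b_j` is orthogonal to the face and its factor is zero.
  have hb : ∀ j, v (.inr j) ∈ vectorSpan ℝ F := by
    intro j
    by_cases hl0 : l (v (.inr j)) = 0
    · obtain ⟨p, hp⟩ := hMne
      obtain ⟨⟨⟨a, b⟩, w⟩, ⟨hab, -⟩, rfl⟩ := hp.1
      rw [← parabPoint_update v (a * h) (b * h) w j]
      have key : ∀ c : Bool, parabPoint v (a * h) (b * h) (bits (Function.update w j c)) ∈ M := by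
        intro c
        refine hmem _ hp _ (parabPoint_mem_liftedLattice v h hab _) (le_of_eq ?_)
        change l.toLinearMap _ = l.toLinearMap _
        rw [map_parabPoint, map_parabPoint]
        congr 1
        refine Finset.sum_congr rfl fun i _ => ?_
        by_cases hij : i = j
        · subst hij
          change _ * l _ = _ * l _
          rw [hl0]; simp
        · simp [bits, hij]
      exact hE _ (key true) _ (key false)
    · exfalso
      refine Finset.prod_ne_zero_iff.1 hprod j (Finset.mem_univ j) (horth _ ?_ _ (hproj _))
      have hdir : ∀ p ∈ M, inner ℝ (v (.inr j)) p = if 0 < l (v (.inr j)) then (1 : ℝ) else 0 := by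
        intro p hp
        obtain ⟨⟨⟨a, b⟩, w⟩, ⟨hab, -⟩, rfl⟩ := hp.1
        simp only
        rw [inner_inr_parabPoint hv]
        have h1 := congrArg l (parabPoint_update v (a * h) (b * h) w j)
        rw [map_sub] at h1
        have h2 := hmax _ hp _ (parabPoint_mem_liftedLattice v h hab (Function.update w j true))
        have h3 := hmax _ hp _ (parabPoint_mem_liftedLattice v h hab (Function.update w j false))
        simp only at h2 h3
        cases hw : w j
        · rw [show Function.update w j false = w by rw [← hw, Function.update_eq_self]] at h1
          rw [if_neg (show ¬ 0 < l (v (.inr j)) by linarith)]; simp [bits, hw]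
        · rw [show Function.update w j true = w by rw [← hw, Function.update_eq_self]] at h1
          rw [if_pos (lt_of_le_of_ne (by linarith) (Ne.symm hl0))]; simp [bits, hw]
      intro p hp q hq
      rw [hdir p hp, hdir q hq]
  -- On lifted points `l` splits into a function of `x`, one of `y` and one of the bits, so two
  -- maximizers may exchange a coordinate. This uses that the grid is a product.
  have hexch : ∀ (a b a' b' : ℕ) (w w' : Fin m → Bool),
      parabPoint v (a * h) (b * h) (bits w) ∈ M → parabPoint v (a' * h) (b' * h) (bits w') ∈ M →
      (a, b) ∈ A ×ˢ B → (a', b') ∈ A ×ˢ B → parabPoint v (a' * h) (b * h) (bits w) ∈ M ∧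
        parabPoint v (a * h) (b' * h) (bits w) ∈ M := by
    intro a b a' b' w w' hp hq hab hab'
    have m1 := parabPoint_mem_liftedLattice v h (show (a', b) ∈ A ×ˢ B from ⟨hab'.1, hab.2⟩) w
    have m2 := parabPoint_mem_liftedLattice v h (show (a, b') ∈ A ×ˢ B from ⟨hab.1, hab'.2⟩) w
    have m3 := parabPoint_mem_liftedLattice v h (show (a', b) ∈ A ×ˢ B from ⟨hab'.1, hab.2⟩) w'
    have m4 := parabPoint_mem_liftedLattice v h (show (a, b') ∈ A ×ˢ B from ⟨hab.1, hab'.2⟩) w'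
    have i3 := hmax _ hp _ m3
    have i4 := hmax _ hp _ m4
    have e1 := hmax _ hp _ hq.1
    have e2 := hmax _ hq _ hp.1
    have L := map_parabPoint v l.toLinearMap
    simp only [ContinuousLinearMap.coe_coe] at L
    refine ⟨hmem _ hp _ m1 ?_, hmem _ hp _ m2 ?_⟩ <;>
    · simp only [L] at *
      linarith
  -- A face varying in both `x` and `y` would contain the `m + 2` independent directions `dX`, `dY`,
  -- `b_j`, one too many.
  have hindep : (∀ p ∈ M, ∀ q ∈ M, inner ℝ (v (.inl 0)) p = (inner ℝ (v (.inl 0)) q : ℝ)) ∨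
      (∀ p ∈ M, ∀ q ∈ M, inner ℝ (v (.inl 1)) p = (inner ℝ (v (.inl 1)) q : ℝ)) := by
    by_contra! hcon
    obtain ⟨⟨p, hp, q, hq, hpq⟩, ⟨p', hp', q', hq', hpq'⟩⟩ := hcon
    obtain ⟨⟨⟨a, b⟩, w⟩, ⟨hab, -⟩, rfl⟩ := hp.1
    obtain ⟨⟨⟨c, d⟩, w₁⟩, ⟨hcd, -⟩, rfl⟩ := hq.1
    obtain ⟨⟨⟨a', b'⟩, w'⟩, ⟨hab', -⟩, rfl⟩ := hp'.1
    obtain ⟨⟨⟨c', d'⟩, w₁'⟩, ⟨hcd', -⟩, rfl⟩ := hq'.1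
    simp only [inner_zero_parabPoint hv, inner_one_parabPoint hv] at hpq hpq'
    have hX := hE _ hp _ (hexch a b c d w w₁ hp hq hab hcd).1
    have hY := hE _ hp' _ (hexch a' b' c' d' w' w₁' hp' hq' hab' hcd').2
    simp only at hX hY
    set dX := parabPoint v (a * h) (b * h) (bits w) - parabPoint v (c * h) (b * h) (bits w)
    set dY := parabPoint v (a' * h) (b' * h) (bits w') - parabPoint v (a' * h) (d' * h) (bits w')
    let g : Fin 2 ⊕ Fin m → vectorSpan ℝ F :=
      Sum.elim ![⟨dX, hX⟩, ⟨dY, hY⟩] fun j => ⟨v (.inr j), hb j⟩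
    have hlin : LinearIndependent ℝ g := by
      rw [Fintype.linearIndependent_iff]
      intro c' hc'
      have hsum := congrArg (Subtype.val) hc'
      simp only [Fintype.sum_sum_type, Fin.sum_univ_two, g, Sum.elim_inl, Sum.elim_inr,
        Submodule.coe_add, Submodule.coe_sum, Submodule.coe_smul, Matrix.cons_val_zero,
        Matrix.cons_val_one, Submodule.coe_zero] at hsum
      have h0 := congrArg (inner ℝ (v (.inl 0))) hsum
      have h1 := congrArg (inner ℝ (v (.inl 1))) hsum
      have h2 := fun j => congrArg (inner ℝ (v (.inr j))) hsum
      simp only [dX, dY, inner_add_right, inner_sum, inner_smul_right, inner_sub_right,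
        inner_zero_parabPoint hv, inner_one_parabPoint hv, inner_inr_parabPoint hv, inner_frame hv,
        inner_zero_right] at h0 h1 h2
      simp [sub_eq_zero, hpq] at h0
      simp [sub_eq_zero, hpq'] at h1
      simp at h2
      rintro (i | j)
      · fin_cases i
        · exact h0
        · exact h1
      · exact h2 j
    have := hlin.fintype_card_le_finrank
    rw [hdim] at this
    simp at this
    omega
  rcases hindep with h0 | h0
  · have hz := horth _ h0
    refine hXY ?_
    rw [(Submodule.starProjection_apply_eq_zero_iff _).2, inner_zero_right]
    rw [Submodule.mem_orthogonal]
    intro e he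
    rw [real_inner_comm]
    exact hz e he
  · exact hXY (horth _ h0 _ (hproj _))

end Paraboloid

end

noncomputable section

/-! ### Hausdorff convergence to the paraboloid body -/

section Convergence

variable {V : Type*} [NormedAddCommGroup V] [InnerProductSpace ℝ V] {m : ℕ}

theorem dist_parabPoint_le {v : Fin 3 ⊕ Fin m → V} (hv : Orthonormal ℝ v) {x y x' y' : ℝ}
    (hx : x ∈ Set.Icc (0 : ℝ) 1) (hy : y ∈ Set.Icc (0 : ℝ) 1) (hx' : x' ∈ Set.Icc (0 : ℝ) 1)
    (hy' : y' ∈ Set.Icc (0 : ℝ) 1) (t : Fin m → ℝ) :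
    dist (parabPoint v x y t) (parabPoint v x' y' t) ≤ 2 * (|x - x'| + |y - y'|) := by
  have hdiff : parabPoint v x y t - parabPoint v x' y' t =
      (x - x') • v (.inl 0) + (y - y') • v (.inl 1) +
        (-((x - x') * ((x + x') / 2)) - (y - y') * ((y + y') / 2)) • v (.inl 2) := by
    unfold parabPoint
    module
  have hs : ∀ {a c : ℝ}, |c| ≤ 1 → |a * c| ≤ |a| := fun {a c} hc => by
    rw [abs_mul]; exact mul_le_of_le_one_right (abs_nonneg _) hc
  have h1 : |(x - x') * ((x + x') / 2)| ≤ |x - x'| :=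
    hs (abs_le.2 ⟨by linarith [hx.1, hx'.1], by linarith [hx.2, hx'.2]⟩)
  have h2 : |(y - y') * ((y + y') / 2)| ≤ |y - y'| :=
    hs (abs_le.2 ⟨by linarith [hy.1, hy'.1], by linarith [hy.2, hy'.2]⟩)
  rw [dist_eq_norm, hdiff]
  refine (norm_add₃_le).trans ?_
  rw [norm_smul, norm_smul, norm_smul, hv.1, hv.1, hv.1, mul_one, mul_one, mul_one,
    Real.norm_eq_abs, Real.norm_eq_abs, Real.norm_eq_abs]
  have h3 := abs_sub (-((x - x') * ((x + x') / 2))) ((y - y') * ((y + y') / 2))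
  rw [abs_neg] at h3
  linarith

/-- The part of the paraboloid over the unit square, times the vertices of the cube. -/
def parabSet (v : Fin 3 ⊕ Fin m → V) : Set V :=
  (fun q : (ℝ × ℝ) × (Fin m → Bool) => parabPoint v q.1.1 q.1.2 (bits q.2)) ''
    ((Set.Icc (0 : ℝ) 1 ×ˢ Set.Icc (0 : ℝ) 1) ×ˢ Set.univ)

theorem isCompact_parabSet (v : Fin 3 ⊕ Fin m → V) : IsCompact (parabSet v) := by
  refine ((isCompact_Icc.prod isCompact_Icc).prod Set.finite_univ.isCompact).image ?_
  have : Continuous (bits : (Fin m → Bool) → Fin m → ℝ) :=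
    continuous_pi fun j =>
      (continuous_of_discreteTopology (f := fun c : Bool => if c then (1 : ℝ) else 0)).comp
        (continuous_apply j)
  have hj : ∀ j, Continuous fun q : (ℝ × ℝ) × (Fin m → Bool) => bits q.2 j := fun j =>
    (continuous_apply j).comp (this.comp continuous_snd)
  unfold parabPoint
  fun_prop

variable [FiniteDimensional ℝ V]

/-- The closed convex hull of `parabSet v`. -/
def parabBody (v : Fin 3 ⊕ Fin m → V) : ConvexBody V where
  carrier := closure (convexHull ℝ (parabSet v))
  convex' := (convex_convexHull ℝ _).closure
  isCompact' := Metric.isCompact_of_isClosed_isBounded isClosed_closure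
    (isBounded_convexHull.2 (isCompact_parabSet v).isBounded).closure
  nonempty' := ⟨_, subset_closure (subset_convexHull ℝ _
    ⟨((0, 0), fun _ => true), ⟨⟨by simp, by simp⟩, Set.mem_univ _⟩, rfl⟩)⟩

/-- The polytope is inscribed, and closed thickenings of convex sets are closed and convex, so it is
enough to approximate points of `parabSet`. The constant is `2 * (2h + 2h)` from
`dist_parabPoint_le`. -/
theorem dist_latticeBody_parabBody_le {v : Fin 3 ⊕ Fin m → V} (hv : Orthonormal ℝ v) {h : ℝ}
    (h0 : 0 ≤ h) {D : Set (ℕ × ℕ)} (hD : D.Finite) (hne : D.Nonempty)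
    (hD1 : ∀ q ∈ D, (q.1 : ℝ) * h ≤ 1 ∧ (q.2 : ℝ) * h ≤ 1)
    (hD2 : ∀ x ∈ Set.Icc (0 : ℝ) 1, ∀ y ∈ Set.Icc (0 : ℝ) 1,
      ∃ q ∈ D, |x - q.1 * h| ≤ 2 * h ∧ |y - q.2 * h| ≤ 2 * h) :
    dist (latticeBody v h D hD hne) (parabBody v) ≤ 8 * h := by
  rw [← ConvexBody.hausdorffDist_coe]
  have hIcc : ∀ q ∈ D, (q.1 : ℝ) * h ∈ Set.Icc (0 : ℝ) 1 ∧ (q.2 : ℝ) * h ∈ Set.Icc (0 : ℝ) 1 :=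
    fun q hq => ⟨⟨by positivity, (hD1 q hq).1⟩, ⟨by positivity, (hD1 q hq).2⟩⟩
  have hcpt : IsCompact (latticeBody v h D hD hne : Set V) := ConvexBody.isCompact _
  refine Metric.hausdorffDist_le_of_mem_dist (by positivity) (fun p hp => ⟨p, ?_, ?_⟩) ?_
  · refine subset_closure (convexHull_mono ?_ hp)
    rintro _ ⟨⟨q, w⟩, ⟨hq, -⟩, rfl⟩
    exact ⟨((q.1 * h, q.2 * h), w), ⟨hIcc q hq, Set.mem_univ _⟩, rfl⟩
  · rw [dist_self]; positivity
  · have hsub : closure (convexHull ℝ (parabSet v)) ⊆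
        Metric.cthickening (8 * h) (latticeBody v h D hD hne : Set V) := by
      refine closure_minimal (convexHull_min ?_ ?_) Metric.isClosed_cthickening
      · rintro _ ⟨⟨⟨x, y⟩, w⟩, ⟨⟨hx, hy⟩, -⟩, rfl⟩
        obtain ⟨q, hq, hqx, hqy⟩ := hD2 x hx y hy
        refine Metric.mem_cthickening_of_dist_le _ _ _ _
          (subset_convexHull ℝ _ (parabPoint_mem_liftedLattice v h hq w)) ?_
        refine (dist_parabPoint_le hv hx hy (hIcc q hq).1 (hIcc q hq).2 _).trans ?_
        simp only
        linarith
      · exact (ConvexBody.convex _).cthickening _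
    intro p hp
    have := hsub hp
    rw [hcpt.cthickening_eq_biUnion_closedBall (by positivity)] at this
    simpa using this

end Convergence

/-! ### The two grids -/

section Lattices

/-- The square grid `{0, …, N}²`. -/
def squareGrid (N : ℕ) : Set (ℕ × ℕ) := Set.Iic N ×ˢ Set.Iic N

/-- The points of the square grid with even coordinate sum. -/
def evenGrid (N : ℕ) : Set (ℕ × ℕ) := {q ∈ squareGrid N | Even (q.1 + q.2)}

theorem finite_squareGrid (N : ℕ) : (squareGrid N).Finite :=
  (Set.finite_Iic N).prod (Set.finite_Iic N)

theorem finite_evenGrid (N : ℕ) : (evenGrid N).Finite :=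
  (finite_squareGrid N).subset fun _ hq => hq.1

theorem nonempty_squareGrid (N : ℕ) : (squareGrid N).Nonempty := ⟨(0, 0), by simp [squareGrid]⟩

theorem nonempty_evenGrid (N : ℕ) : (evenGrid N).Nonempty :=
  ⟨(0, 0), by simp [evenGrid, squareGrid]⟩

theorem cast_mul_inv_le_one {N a : ℕ} (h : a ≤ N) : (a : ℝ) * (N : ℝ)⁻¹ ≤ 1 := by
  rw [← div_eq_mul_inv]
  exact div_le_one_of_le₀ (by exact_mod_cast h) (by positivity)

theorem exists_evenGrid_near {N : ℕ} (hN : 1 ≤ N) {x y : ℝ} (hx : x ∈ Set.Icc (0 : ℝ) 1)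
    (hy : y ∈ Set.Icc (0 : ℝ) 1) : ∃ q ∈ evenGrid N,
      |x - q.1 * (N : ℝ)⁻¹| ≤ 2 * (N : ℝ)⁻¹ ∧ |y - q.2 * (N : ℝ)⁻¹| ≤ 2 * (N : ℝ)⁻¹ := by
  have hN0 : (0 : ℝ) < N := by exact_mod_cast hN
  have hscale : ∀ z : ℝ, ∀ a : ℕ, |z * N - a| ≤ 2 → |z - a * (N : ℝ)⁻¹| ≤ 2 * (N : ℝ)⁻¹ := by
    intro z a ha
    have : z - a * (N : ℝ)⁻¹ = (z * N - a) * (N : ℝ)⁻¹ := by field_simp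
    rw [this, abs_mul, abs_of_pos (inv_pos.2 hN0)]
    gcongr
  have hfloor : ∀ z ∈ Set.Icc (0 : ℝ) 1, ⌊z * N⌋₊ ≤ N ∧ (⌊z * N⌋₊ : ℝ) ≤ z * N ∧
      z * N < ⌊z * N⌋₊ + 1 := fun z hz =>
    ⟨Nat.floor_le_of_le (mul_le_of_le_one_left hN0.le hz.2),
      Nat.floor_le (mul_nonneg hz.1 hN0.le), Nat.lt_floor_add_one _⟩
  obtain ⟨ha, ha1, ha2⟩ := hfloor x hx
  obtain ⟨hb, hb1, hb2⟩ := hfloor y hy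
  set a := ⌊x * N⌋₊
  set b := ⌊y * N⌋₊
  have hxa : |x * N - a| ≤ 2 := abs_le.2 ⟨by linarith, by linarith⟩
  -- Wrong parity is repaired by moving `b` one step down, or up when `b = 0`; this costs at most
  -- one more mesh width.
  obtain ⟨b', hb', hbe, hyb⟩ : ∃ b' ≤ N, Even (a + b') ∧ |y * N - b'| ≤ 2 := by
    rcases Nat.even_or_odd (a + b) with he | ho
    · exact ⟨b, hb, he, abs_le.2 ⟨by linarith, by linarith⟩⟩
    · rcases Nat.eq_zero_or_pos b with hb0 | hbpos
      · refine ⟨b + 1, by omega, by rw [← add_assoc]; exact ho.add_one, ?_⟩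
        push_cast
        exact abs_le.2 ⟨by linarith, by linarith⟩
      · obtain ⟨c, hc⟩ : ∃ c, b = c + 1 := ⟨b - 1, by omega⟩
        refine ⟨c, by omega, ?_, ?_⟩
        · rw [hc, ← add_assoc, Nat.odd_add_one, Nat.not_odd_iff_even] at ho
          exact ho
        · rw [hc] at hb1 hb2
          push_cast at hb1 hb2
          exact abs_le.2 ⟨by linarith, by linarith⟩
  exact ⟨(a, b'), ⟨⟨ha, hb'⟩, hbe⟩, hscale x a hxa, hscale y b' hyb⟩

end Lattices

end

open scoped Pointwise

noncomputable section

/-! ### Lower bounds for face volumes and exterior angles -/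

section Measures

variable {V : Type*} [NormedAddCommGroup V] [InnerProductSpace ℝ V] [FiniteDimensional ℝ V]
  [MeasurableSpace V] [BorelSpace V]

/-- A set containing a translate of a box with orthogonal edges has at least the volume of the
box. -/
theorem prod_abs_le_faceVolume {ι : Type*} [Fintype ι] {o : ι → V} (ho : Orthonormal ℝ o)
    (c : ι → ℝ) (p : V) {F : Set V} (hF : Bornology.IsBounded F)
    (hspan : vectorSpan ℝ F = Submodule.span ℝ (Set.range o))
    (hbox : ∀ x ∈ parallelepiped (fun i => c i • o i), p + x ∈ F) :
    ∏ i, |c i| ≤ faceVolume F := by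
  classical
  have hmem : ∀ i, o i ∈ vectorSpan ℝ F := fun i => by
    rw [hspan]; exact Submodule.subset_span ⟨i, rfl⟩
  let o' : ι → vectorSpan ℝ F := fun i => ⟨o i, hmem i⟩
  have ho' : Orthonormal ℝ o' := by
    rw [orthonormal_iff_ite] at ho ⊢
    exact ho
  have hcard : Fintype.card ι = Module.finrank ℝ (vectorSpan ℝ F) := by
    rw [hspan]; exact (finrank_span_eq_card ho.linearIndependent).symm
  let b : OrthonormalBasis ι ℝ (vectorSpan ℝ F) :=
    OrthonormalBasis.mk ho' (ho'.linearIndependent.span_eq_top_of_card_eq_finrank' hcard).ge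
  have hb : ∀ i, b i = o' i := fun i => by simp [b]
  set π := (vectorSpan ℝ F).orthogonalProjectionOnto with hπ
  have hvol : (volume : Measure (vectorSpan ℝ F)).real (parallelepiped fun i => c i • b i) =
      ∏ i, |c i| := by
    have hdet : b.toBasis.det (fun i => c i • b i) = ∏ i, c i := by
      have := b.toBasis.det.toMultilinearMap.map_smul_univ c b
      have h1 : b.toBasis.det b = 1 := by
        rw [← b.coe_toBasis]; exact b.toBasis.det_self
      simp only [AlternatingMap.coe_multilinearMap, h1, smul_eq_mul, mul_one] at this
      exact this
    rw [Measure.real, ← b.addHaar_eq_volume, Measure.addHaar_parallelepiped, hdet,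
      ENNReal.toReal_ofReal (abs_nonneg _), Finset.abs_prod]
  have hsub : (fun y => π p + y) '' (parallelepiped fun i => c i • b i) ⊆ π '' F := by
    rintro _ ⟨_, ⟨t, ht, rfl⟩, rfl⟩
    refine ⟨p + ∑ i, t i • c i • o i, hbox _ ⟨t, ht, rfl⟩, ?_⟩
    have hfix : ∀ i, π (o i) = b i := fun i => by
      rw [hb]
      exact Submodule.orthogonalProjectionOnto_mem_subspace_eq_self (o' i)
    simp [hfix]
  -- `Measure.real` sends infinite measure to `0`, so monotonicity needs finiteness.
  have hfin : (volume : Measure (vectorSpan ℝ F)) (π '' F) ≠ ⊤ :=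
    (π.lipschitz.isBounded_image hF).measure_lt_top.ne
  calc ∏ i, |c i| = (volume : Measure (vectorSpan ℝ F)).real
        ((fun y => π p + y) '' (parallelepiped fun i => c i • b i)) := by
        rw [← hvol, Measure.real, Measure.real, Set.image_add_left, measure_preimage_add]
    _ ≤ faceVolume F := measureReal_mono hsub hfin

instance (E : Submodule ℝ V) : IsFiniteMeasure (sphereProb E) := by
  refine ⟨?_⟩
  rw [sphereProb, Measure.smul_apply, smul_eq_mul]
  -- For zero total mass the normalizing factor is `⊤`, but `⊤ * 0 = 0`.
  rcases eq_or_ne ((volume : Measure E).toSphere Set.univ) 0 with h0 | h0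
  · rw [h0]; simp
  · exact ENNReal.mul_lt_top (ENNReal.inv_lt_top.2 (pos_iff_ne_zero.2 h0)) (measure_lt_top _ _)

/-- A measurable part of the sphere whose cone contains a small ball inside the unit ball. -/
theorem pow_le_sphereProb_real {E : Submodule ℝ V} [Nontrivial E] {S : Set V}
    (hS : MeasurableSet S) (hcone : ∀ u ∈ S, ∀ r : ℝ, 0 < r → r • u ∈ S) {c : E} {r : ℝ}
    (hr : 0 ≤ r) (hball : ∀ x ∈ Metric.ball c r, (x : V) ∈ S ∧ x ≠ 0 ∧ ‖x‖ < 1) :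
    r ^ Module.finrank ℝ E ≤
      (sphereProb E).real {u : Metric.sphere (0 : E) 1 | ((u : E) : V) ∈ S} := by
  have hmeas : MeasurableSet {u : Metric.sphere (0 : E) 1 | ((u : E) : V) ∈ S} :=
    (measurable_subtype_coe.comp measurable_subtype_coe) hS
  -- The spherical measure is the dimension times the volume of the cone inside the unit ball. After
  -- normalization the bound is the volume ratio of a ball of radius `r` to the unit ball.
  have hsub : Metric.ball c r ⊆ Set.Ioo (0 : ℝ) 1 •
      ((↑) '' {u : Metric.sphere (0 : E) 1 | ((u : E) : V) ∈ S} : Set E) := by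
    intro x hx
    obtain ⟨hxS, hx0, hx1⟩ := hball x hx
    have hn : 0 < ‖x‖ := norm_pos_iff.2 hx0
    refine Set.mem_smul.2 ⟨‖x‖, ⟨hn, hx1⟩, ‖x‖⁻¹ • x, ⟨⟨‖x‖⁻¹ • x, ?_⟩, ?_, rfl⟩, ?_⟩
    · rw [mem_sphere_zero_iff_norm, norm_smul, norm_inv, norm_norm, inv_mul_cancel₀ hn.ne']
    · exact hcone _ hxS _ (inv_pos.2 hn)
    · rw [smul_smul, mul_inv_cancel₀ hn.ne', one_smul]
  have hd : (Module.finrank ℝ E : ENNReal) ≠ 0 := by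
    exact_mod_cast (Module.finrank_pos (R := ℝ) (M := E)).ne'
  have hB0 : (volume : Measure E) (Metric.ball 0 1) ≠ 0 :=
    (Metric.measure_ball_pos _ _ one_pos).ne'
  have hBt : (volume : Measure E) (Metric.ball 0 1) ≠ ⊤ := measure_ball_lt_top.ne
  have hle : ENNReal.ofReal (r ^ Module.finrank ℝ E) ≤
      sphereProb E {u : Metric.sphere (0 : E) 1 | ((u : E) : V) ∈ S} := by
    rw [sphereProb, Measure.smul_apply, smul_eq_mul, Measure.toSphere_apply' _ hmeas,
      Measure.toSphere_apply_univ]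
    calc ENNReal.ofReal (r ^ Module.finrank ℝ E)
        = (↑(Module.finrank ℝ E) * (volume : Measure E) (Metric.ball 0 1))⁻¹ *
          (↑(Module.finrank ℝ E) * (volume : Measure E) (Metric.ball c r)) := by
          rw [Measure.addHaar_ball _ _ hr, mul_left_comm (Module.finrank ℝ E : ENNReal),
            mul_left_comm, ENNReal.inv_mul_cancel (mul_ne_zero hd hB0)
              (ENNReal.mul_ne_top (ENNReal.natCast_ne_top _) hBt), mul_one]
      _ ≤ _ := by gcongr
  rw [Measure.real, ← ENNReal.ofReal_le_iff_le_toReal (measure_ne_top _ _)]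
  exact hle

end Measures

/-! ### Subspaces parallel to a diagonal edge times the cube -/

section EdgeSpace

variable {V : Type*} [NormedAddCommGroup V] [InnerProductSpace ℝ V] {m : ℕ}

/-- An edge of the lifted even grid, over a segment in direction `(1, 1)`. -/
def edgeVec (v : Fin 3 ⊕ Fin m → V) (μ : ℝ) : V := v (.inl 0) + v (.inl 1) - μ • v (.inl 2)

/-- The normalized edge direction, followed by the edges of the cube. -/
def edgeFrame (v : Fin 3 ⊕ Fin m → V) (μ : ℝ) : Option (Fin m) → V
  | none => (√(2 + μ ^ 2))⁻¹ • edgeVec v μ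
  | some j => v (.inr j)

/-- The linear subspace parallel to the product of an edge and the cube. -/
def edgeSpace (v : Fin 3 ⊕ Fin m → V) (μ : ℝ) : Submodule ℝ V :=
  Submodule.span ℝ (Set.range (edgeFrame v μ))

variable {v : Fin 3 ⊕ Fin m → V} (hv : Orthonormal ℝ v) (μ : ℝ)

theorem sqrt_smul_edgeFrame_none : √(2 + μ ^ 2) • edgeFrame v μ none = edgeVec v μ := by
  have : √(2 + μ ^ 2) ≠ 0 := (Real.sqrt_pos.2 (by positivity)).ne'
  rw [edgeFrame, smul_smul, mul_inv_cancel₀ this, one_smul]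

theorem edgeVec_mem_edgeSpace : edgeVec v μ ∈ edgeSpace v μ := by
  rw [← sqrt_smul_edgeFrame_none]
  exact Submodule.smul_mem _ _ (Submodule.subset_span ⟨none, rfl⟩)

theorem inr_mem_edgeSpace (j : Fin m) : v (.inr j) ∈ edgeSpace v μ :=
  Submodule.subset_span ⟨some j, rfl⟩

theorem edgeSpace_le {E : Submodule ℝ V} (h0 : edgeVec v μ ∈ E) (h1 : ∀ j, v (.inr j) ∈ E) :
    edgeSpace v μ ≤ E := by
  refine Submodule.span_le.2 ?_
  rintro _ ⟨_ | j, rfl⟩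
  · exact Submodule.smul_mem _ _ h0
  · exact h1 j

theorem mem_orthogonal_edgeSpace {u : V} (h0 : inner ℝ u (edgeVec v μ) = (0 : ℝ))
    (h1 : ∀ j, inner ℝ u (v (.inr j)) = (0 : ℝ)) : u ∈ (edgeSpace v μ)ᗮ := by
  rw [Submodule.mem_orthogonal']
  have hle : edgeSpace v μ ≤ (innerₛₗ ℝ u).ker := edgeSpace_le μ h0 h1
  exact fun x hx => hle hx

include hv

theorem inner_edgeVec_self : inner ℝ (edgeVec v μ) (edgeVec v μ) = 2 + μ ^ 2 := by
  simp only [edgeVec, inner_sub_left, inner_sub_right, inner_add_left, inner_add_right,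
    real_inner_smul_left, real_inner_smul_right, inner_frame hv]
  simp
  ring

theorem orthonormal_edgeFrame : Orthonormal ℝ (edgeFrame v μ) := by
  have hpos : 0 < 2 + μ ^ 2 := by positivity
  rw [orthonormal_iff_ite]
  rintro (_ | i) (_ | j)
  · simp only [edgeFrame, real_inner_smul_left, real_inner_smul_right, inner_edgeVec_self hv]
    rw [if_pos trivial, ← mul_assoc, ← mul_inv, Real.mul_self_sqrt hpos.le, inv_mul_cancel₀ hpos.ne']
  · simp [edgeFrame, edgeVec, inner_sub_left, inner_add_left, real_inner_smul_left, inner_frame hv]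
  · simp [edgeFrame, edgeVec, inner_sub_right, inner_add_right, real_inner_smul_right,
      inner_frame hv]
  · simp [edgeFrame, inner_frame hv]

theorem finrank_edgeSpace : Module.finrank ℝ (edgeSpace v μ) = m + 1 := by
  rw [edgeSpace, finrank_span_eq_card (orthonormal_edgeFrame hv μ).linearIndependent]
  simp

/-- The cube factors equal `1`, and `⟪v₁, P v₀⟫ = 1 / (2 + μ²) ≥ 1/3` gets squared. -/
theorem entryPoly_edgeSpace [FiniteDimensional ℝ V] (hμ : μ ^ 2 ≤ 1) :
    1 / 9 ≤ OrthFlag.entryPoly v (edgeSpace v μ).starProjection := by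
  have hpos : 0 < 2 + μ ^ 2 := by positivity
  have h1 : ∀ j, (edgeSpace v μ).starProjection (v (.inr j)) = v (.inr j) := fun j =>
    Submodule.starProjection_eq_self_iff.2 (inr_mem_edgeSpace μ j)
  have h0 : (edgeSpace v μ).starProjection (v (.inl 0)) = (2 + μ ^ 2)⁻¹ • edgeVec v μ := by
    refine Submodule.eq_starProjection_of_mem_orthogonal
      (Submodule.smul_mem _ _ (edgeVec_mem_edgeSpace μ)) (mem_orthogonal_edgeSpace μ ?_ ?_)
    · rw [inner_sub_left, real_inner_smul_left, inner_edgeVec_self hv, inv_mul_cancel₀ hpos.ne']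
      simp [edgeVec, inner_sub_right, inner_add_right, real_inner_smul_right, inner_frame hv, hv.1]
    · intro j
      simp [edgeVec, inner_sub_left, inner_add_left, real_inner_smul_left, inner_frame hv]
  have h2 : inner ℝ (v (.inl 1)) (edgeVec v μ) = (1 : ℝ) := by
    simp [edgeVec, inner_sub_right, inner_add_right, real_inner_smul_right, inner_frame hv, hv.1]
  have h3 : (1 / 3 : ℝ) ≤ (2 + μ ^ 2)⁻¹ := by
    rw [← one_div]; exact one_div_le_one_div_of_le hpos (by linarith)
  simp only [OrthFlag.entryPoly, h1, h0, real_inner_smul_right, h2, inner_frame hv]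
  simp only [if_true, Finset.prod_const_one, one_mul, mul_one]
  nlinarith

/-- The directions orthogonal to an edge that lie within a fixed angle of the vertical have
probability bounded below. -/
theorem pow_le_sphereProb_edgeSpace [FiniteDimensional ℝ V] [MeasurableSpace V] [BorelSpace V]
    (hμ0 : 0 ≤ μ) (hμ1 : μ ≤ 1) :
    (1 / 10 : ℝ) ^ Module.finrank ℝ (edgeSpace v μ)ᗮ ≤
      (sphereProb (edgeSpace v μ)ᗮ).real {u | (((u : (edgeSpace v μ)ᗮ)) : V) ∈
        {x : V | 0 < (inner ℝ x (v (.inl 2)) : ℝ) ∧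
          |(inner ℝ x (v (.inl 0)) : ℝ) - inner ℝ x (v (.inl 1))| ≤
            (inner ℝ x (v (.inl 2)) : ℝ) / 2}} := by
  -- Here `n` is normal to the edge, has equal `v₀`- and `v₁`-components and `v₂`-component `1/2`.
  -- Within distance `1/10` the last is at least `2/5` and the first two differ by at most `1/5`;
  -- `‖n‖ < 9/10` keeps this ball inside the unit ball.
  let n : V := (μ / 4) • (v (.inl 0) + v (.inl 1)) + (1 / 2 : ℝ) • v (.inl 2)
  have hn : n ∈ (edgeSpace v μ)ᗮ := by
    refine mem_orthogonal_edgeSpace μ ?_ fun j => ?_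
    · simp [n, edgeVec, inner_sub_right, inner_add_right, inner_add_left, real_inner_smul_left,
        real_inner_smul_right, inner_frame hv, hv.1]
      ring
    · simp [n, inner_add_left, real_inner_smul_left, inner_frame hv]
  have hn0 : inner ℝ n (v (.inl 0)) = μ / 4 := by
    simp [n, inner_add_left, real_inner_smul_left, inner_frame hv, hv.1]
  have hn1 : inner ℝ n (v (.inl 1)) = μ / 4 := by
    simp [n, inner_add_left, real_inner_smul_left, inner_frame hv, hv.1]
  have hn2 : inner ℝ n (v (.inl 2)) = (1 / 2 : ℝ) := by
    simp [n, inner_add_left, real_inner_smul_left, inner_frame hv, hv.1]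
  have hnn : ‖n‖ < 9 / 10 := by
    have : inner ℝ n n = μ ^ 2 / 8 + 1 / 4 := by
      conv_lhs => rw [show n = (μ / 4) • (v (.inl 0) + v (.inl 1)) + (1 / 2 : ℝ) • v (.inl 2)
        from rfl, inner_add_right, real_inner_smul_right, real_inner_smul_right, inner_add_right]
      change μ / 4 * (inner ℝ n (v (.inl 0)) + inner ℝ n (v (.inl 1))) +
        1 / 2 * inner ℝ n (v (.inl 2)) = _
      rw [hn0, hn1, hn2]; ring
    rw [real_inner_self_eq_norm_sq] at this
    nlinarith [norm_nonneg n]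
  have hnontriv : Nontrivial (edgeSpace v μ)ᗮ := by
    refine ⟨⟨⟨n, hn⟩, 0, fun h => ?_⟩⟩
    have : n = 0 := congrArg Subtype.val h
    rw [this, inner_zero_left] at hn2
    norm_num at hn2
  have hc : ∀ i, Continuous fun x : V => (inner ℝ x (v i) : ℝ) := fun i =>
    continuous_id.inner continuous_const
  refine pow_le_sphereProb_real ?_ ?_ (c := ⟨n, hn⟩) (by norm_num) ?_
  · refine MeasurableSet.inter ?_ ?_
    · exact (isOpen_lt continuous_const (hc _)).measurableSet
    · exact (isClosed_le ((hc _).sub (hc _)).abs ((hc _).div_const 2)).measurableSet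
  · rintro u ⟨hu0, hu1⟩ r hr
    simp only [Set.mem_ofPred_eq, real_inner_smul_left]
    refine ⟨mul_pos hr hu0, ?_⟩
    rw [← mul_sub, abs_mul, abs_of_pos hr, mul_div_assoc]
    exact mul_le_mul_of_nonneg_left hu1 hr.le
  · intro x hx
    have hd : ‖(x : V) - n‖ < 1 / 10 := by
      rw [Metric.mem_ball, dist_eq_norm] at hx
      exact hx
    have hi : ∀ i, |inner ℝ (x : V) (v i) - inner ℝ n (v i)| ≤ 1 / 10 := fun i => by
      rw [← inner_sub_left]
      refine (abs_real_inner_le_norm _ _).trans ?_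
      rw [hv.1, mul_one]
      exact hd.le
    have i0 := abs_le.1 (hi (.inl 0))
    have i1 := abs_le.1 (hi (.inl 1))
    have i2 := abs_le.1 (hi (.inl 2))
    rw [hn0] at i0
    rw [hn1] at i1
    rw [hn2] at i2
    refine ⟨⟨by linarith, abs_le.2 ⟨by linarith, by linarith⟩⟩, ?_, ?_⟩
    · rintro rfl
      rw [Submodule.coe_zero, inner_zero_left] at i2
      linarith
    · have := norm_sub_norm_le (x : V) n
      change ‖(x : V)‖ < 1
      linarith

end EdgeSpace

end

noncomputable section

/-! ### Parity inequalities on the even lattice -/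

section IntegerInequalities

/-- With `p + q = 2s` and `r = p - s`, the right side minus `±(p - q)` is `2s(s - 1) + 2r(r ∓ 1)`,
built from products of consecutive integers. Parity is essential: `(1, 0)` violates the bound. The
quadratic form measures how far a lifted point lies below the supporting hyperplane at the edge from
`(0, 0)` to `(1, 1)`. -/
theorem abs_sub_le_of_even {p q : ℤ} (h : Even (p + q)) :
    |p - q| ≤ p ^ 2 + q ^ 2 - p - q := by
  obtain ⟨s, hs⟩ := h
  obtain rfl : q = 2 * s - p := by omega
  have h1 : 0 ≤ s * (s - 1) := by
    rcases le_or_gt s 0 with h | h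
    · nlinarith
    · nlinarith
  have h2 : 0 ≤ (p - s) * (p - s - 1) := by
    rcases le_or_gt (p - s) 0 with h | h
    · nlinarith
    · nlinarith
  have h3 : 0 ≤ (p - s) * (p - s + 1) := by
    rcases le_or_gt 0 (p - s) with h | h
    · nlinarith
    · nlinarith
  exact abs_le.2 ⟨by nlinarith, by nlinarith⟩

theorem eq_zero_or_one_of_even {p q : ℤ} (h : Even (p + q)) (h0 : p ^ 2 + q ^ 2 - p - q ≤ 0) :
    (p = 0 ∧ q = 0) ∨ (p = 1 ∧ q = 1) := by
  have h1 : p - q = 0 := abs_nonpos_iff.1 ((abs_sub_le_of_even h).trans h0)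
  obtain rfl : p = q := by omega
  have : p * (p - 1) ≤ 0 := by nlinarith
  have h2 : 0 ≤ p := by by_contra hc; nlinarith
  have h3 : p ≤ 1 := by by_contra hc; nlinarith
  omega

theorem real_abs_sub_le_of_even {a b c d : ℕ} (h : Even (a + b)) (h' : Even (c + d)) :
    |((c : ℝ) - a) - (d - b)| ≤ ((c : ℝ) - a) ^ 2 + (d - b) ^ 2 - (c - a) - (d - b) := by
  have he : Even (((c : ℤ) - a) + (d - b)) := by
    have : ((c : ℤ) - a) + (d - b) = ((c + d : ℕ) : ℤ) - ((a + b : ℕ) : ℤ) := by push_cast; ring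
    rw [this]
    exact ((Int.even_coe_nat _).2 h').sub ((Int.even_coe_nat _).2 h)
  exact_mod_cast abs_sub_le_of_even he

theorem nat_eq_of_even {a b c d : ℕ} (h : Even (a + b)) (h' : Even (c + d))
    (h0 : ((c : ℝ) - a) ^ 2 + (d - b) ^ 2 - (c - a) - (d - b) ≤ 0) :
    (c = a ∧ d = b) ∨ (c = a + 1 ∧ d = b + 1) := by
  have he : Even (((c : ℤ) - a) + (d - b)) := by
    have : ((c : ℤ) - a) + (d - b) = ((c + d : ℕ) : ℤ) - ((a + b : ℕ) : ℤ) := by push_cast; ring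
    rw [this]
    exact ((Int.even_coe_nat _).2 h').sub ((Int.even_coe_nat _).2 h)
  have h1 : ((c : ℤ) - a) ^ 2 + (d - b) ^ 2 - (c - a) - (d - b) ≤ 0 := by exact_mod_cast h0
  have := eq_zero_or_one_of_even he h1
  omega

end IntegerInequalities

/-! ### Diagonal edges times the cube as faces of the even polytope -/

section EdgeFaces

variable {V : Type*} [NormedAddCommGroup V] [InnerProductSpace ℝ V] {m : ℕ}

/-- The segment from `(a, b)` to `(a + 1, b + 1)`, lifted to the paraboloid, times the cube. -/
def edgeFace (v : Fin 3 ⊕ Fin m → V) (h : ℝ) (a b : ℕ) : Set V :=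
  convexHull ℝ (liftedLattice v h {(a, b), (a + 1, b + 1)})

variable {v : Fin 3 ⊕ Fin m → V} {h : ℝ} {a b : ℕ}

theorem parabPoint_mem_edgeFace (w : Fin m → Bool) :
    parabPoint v (a * h) (b * h) (bits w) ∈ edgeFace v h a b :=
  subset_convexHull ℝ _ (parabPoint_mem_liftedLattice v h (by simp) w)

theorem parabPoint_succ_sub (t : Fin m → ℝ) :
    parabPoint v ((a + 1 : ℕ) * h) ((b + 1 : ℕ) * h) t - parabPoint v (a * h) (b * h) t =
      h • edgeVec v ((a + b + 1) * h) := by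
  unfold parabPoint edgeVec
  push_cast
  module

theorem vectorSpan_edgeFace (hh : 0 < h) :
    vectorSpan ℝ (edgeFace v h a b) = edgeSpace v ((a + b + 1) * h) := by
  rw [edgeFace, vectorSpan_convexHull]
  have hmem : ∀ w, parabPoint v (a * h) (b * h) (bits w) ∈
      liftedLattice v h {(a, b), (a + 1, b + 1)} := fun w =>
    parabPoint_mem_liftedLattice v h (by simp) w
  have hmem' : ∀ w, parabPoint v ((a + 1 : ℕ) * h) ((b + 1 : ℕ) * h) (bits w) ∈
      liftedLattice v h {(a, b), (a + 1, b + 1)} := fun w =>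
    parabPoint_mem_liftedLattice v h (by simp) w
  refine le_antisymm ?_ (edgeSpace_le _ ?_ fun j => ?_)
  · rw [vectorSpan_eq_span_vsub_set_right ℝ (hmem fun _ => false), Submodule.span_le]
    have hcube : ∀ w : Fin m → Bool, parabPoint v (a * h) (b * h) (bits w) -
        parabPoint v (a * h) (b * h) (bits fun _ => false) ∈
          edgeSpace v ((a + b + 1) * h) := by
      intro w
      have : parabPoint v (a * h) (b * h) (bits w) -
          parabPoint v (a * h) (b * h) (bits fun _ => false) = ∑ j, bits w j • v (.inr j) := by
        simp [parabPoint, bits]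
      rw [this]
      exact Submodule.sum_mem _ fun j _ => Submodule.smul_mem _ _ (inr_mem_edgeSpace _ j)
    rintro _ ⟨_, ⟨⟨q, w⟩, ⟨hq, -⟩, rfl⟩, rfl⟩
    rcases hq with hq | hq
    · simp only at hq
      subst hq
      exact hcube w
    · simp only [Set.mem_singleton_iff] at hq
      subst hq
      have := Submodule.add_mem _ (Submodule.smul_mem _ h
        (edgeVec_mem_edgeSpace (v := v) ((a + b + 1) * h))) (hcube w)
      rw [← parabPoint_succ_sub (bits w), sub_add_sub_cancel] at this
      exact this
  · have := vsub_mem_vectorSpan ℝ (hmem' fun _ => false) (hmem fun _ => false)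
    rw [vsub_eq_sub, parabPoint_succ_sub] at this
    exact (Submodule.smul_mem_iff _ hh.ne').1 this
  · rw [← parabPoint_update v (a * h) (b * h) (fun _ => false) j]
    exact vsub_mem_vectorSpan ℝ (hmem _) (hmem _)

/-- The face contains a box with one side `h * √(2 + μ²) ≥ h` and all other sides `1`. -/
theorem le_faceVolume_edgeFace [FiniteDimensional ℝ V] [MeasurableSpace V] [BorelSpace V]
    (hv : Orthonormal ℝ v) (hh : 0 < h) : h ≤ faceVolume (edgeFace v h a b) := by
  set μ : ℝ := (a + b + 1) * h with hμ
  let c : Option (Fin m) → ℝ := fun i => i.elim (h * √(2 + μ ^ 2)) fun _ => 1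
  have hc : (fun i => c i • edgeFrame v μ i) =
      fun i : Option (Fin m) => i.elim (h • edgeVec v μ) fun j => v (.inr j) := by
    funext i
    rcases i with _ | j
    · simp only [c, Option.elim_none]
      rw [mul_smul, sqrt_smul_edgeFrame_none]
    · simp [c, edgeFrame]
  have hbound : Bornology.IsBounded (edgeFace v h a b) :=
    isBounded_convexHull.2 (finite_liftedLattice v h (Set.toFinite _)).isBounded
  refine le_trans ?_ (prod_abs_le_faceVolume (orthonormal_edgeFrame hv μ) c
    (parabPoint v (a * h) (b * h) (bits fun _ => false)) hbound (vectorSpan_edgeFace hh) ?_)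
  · have h1 : 1 ≤ √(2 + μ ^ 2) := Real.one_le_sqrt.2 (by nlinarith [sq_nonneg μ])
    simp only [Fintype.prod_option, c, Option.elim_none, Option.elim_some, abs_one,
      Finset.prod_const_one, mul_one]
    rw [abs_of_pos (by positivity)]
    nlinarith
  · rw [hc, parallelepiped_eq_convexHull]
    intro x hx
    have hsub : (∑ i : Option (Fin m), {0, i.elim (h • edgeVec v μ) fun j => v (.inr j)} : Set V) ⊆
        {x | parabPoint v (a * h) (b * h) (bits fun _ => false) + x ∈ edgeFace v h a b} := by
      intro y hy
      obtain ⟨g, hg, rfl⟩ := (Set.mem_finsetSum _ _ _).1 hy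
      have hg0 := hg (i := none) (Finset.mem_univ _)
      have hg1 : ∀ j : Fin m, g (some j) = 0 ∨ g (some j) = v (.inr j) := fun j => by
        simpa using hg (i := some j) (Finset.mem_univ _)
      classical
      let w : Fin m → Bool := fun j => decide (g (some j) ≠ 0)
      have hw : ∀ j, bits w j • v (.inr j) = g (some j) := fun j => by
        by_cases h0 : g (some j) = 0
        · simp [bits, w, h0]
        · simp [bits, w, h0, ((hg1 j).resolve_left h0).symm]
      have hbase : parabPoint v (a * h) (b * h) (bits fun _ => false) + ∑ j, g (some j) =
          parabPoint v (a * h) (b * h) (bits w) := by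
        simp only [← hw]
        simp [parabPoint, bits]
      simp only [Set.mem_ofPred_eq, Fintype.sum_option]
      rw [add_left_comm, hbase]
      rcases hg0 with h0 | h0
      · rw [h0, zero_add]
        exact parabPoint_mem_edgeFace w
      · rw [Set.mem_singleton_iff] at h0
        rw [h0, Option.elim_none, hμ, ← parabPoint_succ_sub (bits w), sub_add_cancel]
        exact subset_convexHull ℝ _ (parabPoint_mem_liftedLattice v h (by simp) w)
    have hconv : Convex ℝ
        {x | parabPoint v (a * h) (b * h) (bits fun _ => false) + x ∈ edgeFace v h a b} :=
      (convex_convexHull ℝ _).translate_preimage_right _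
    exact convexHull_min hsub hconv hx

/-- The pair `(a h, b h)` is recovered as the coordinatewise minimum over the face. -/
theorem edgeFace_injective (hv : Orthonormal ℝ v) (hh : 0 < h) {a' b' : ℕ}
    (heq : edgeFace v h a b = edgeFace v h a' b') : a = a' ∧ b = b' := by
  have key : ∀ (a b a' b' : ℕ), edgeFace v h a b = edgeFace v h a' b' → a' ≤ a ∧ b' ≤ b := by
    intro a b a' b' heq
    have hmem := parabPoint_mem_edgeFace (v := v) (h := h) (a := a) (b := b) fun _ => false
    rw [heq] at hmem
    have hlow : ∀ x ∈ edgeFace v h a' b', (a' * h : ℝ) ≤ inner ℝ (v (.inl 0)) x ∧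
        (b' * h : ℝ) ≤ inner ℝ (v (.inl 1)) x := by
      have hconv : Convex ℝ {x : V | (a' * h : ℝ) ≤ inner ℝ (v (.inl 0)) x ∧
          (b' * h : ℝ) ≤ inner ℝ (v (.inl 1)) x} :=
        (convex_halfSpace_ge (innerₛₗ ℝ (v (.inl 0))).isLinear _).inter
          (convex_halfSpace_ge (innerₛₗ ℝ (v (.inl 1))).isLinear _)
      refine fun x hx => convexHull_min ?_ hconv hx
      rintro _ ⟨⟨q, w⟩, ⟨hq, -⟩, rfl⟩
      simp only [Set.mem_ofPred_eq, inner_zero_parabPoint hv, inner_one_parabPoint hv]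
      rcases hq with hq | hq
      · simp only at hq
        subst hq
        exact ⟨le_rfl, le_rfl⟩
      · simp only [Set.mem_singleton_iff] at hq
        subst hq
        push_cast
        constructor <;> nlinarith
    have := hlow _ hmem
    rw [inner_zero_parabPoint hv, inner_one_parabPoint hv] at this
    exact ⟨by exact_mod_cast le_of_mul_le_mul_right this.1 hh,
      by exact_mod_cast le_of_mul_le_mul_right this.2 hh⟩
  have h1 := key _ _ _ _ heq
  have h2 := key _ _ _ _ heq.symm
  omega

variable [FiniteDimensional ℝ V] {N : ℕ}

theorem edgeFace_mem_kFaces (hv : Orthonormal ℝ v) (hh : 0 < h) (hab : Even (a + b))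
    (ha : a + 1 ≤ N) (hb : b + 1 ≤ N) :
    edgeFace v h a b ∈ kFaces (m + 1)
      (latticeBody v h (evenGrid N) (finite_evenGrid N) (nonempty_evenGrid N)) := by
  have hsub : ({(a, b), (a + 1, b + 1)} : Set (ℕ × ℕ)) ⊆ evenGrid N := by
    rintro q (rfl | rfl)
    · exact ⟨⟨by simp; omega, by simp; omega⟩, hab⟩
    · exact ⟨⟨ha, hb⟩, by
        simp only
        rw [show a + 1 + (b + 1) = a + b + 2 by ring]
        exact hab.add even_two⟩
  refine ⟨⟨_, parabPoint_mem_edgeFace fun _ => false⟩, ?_, ?_⟩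
  · let n : V := ((a + 1 / 2) * h) • v (.inl 0) + ((b + 1 / 2) * h) • v (.inl 1) + v (.inl 2)
    have hval : ∀ (c d : ℕ) (w : Fin m → Bool),
        innerSL ℝ n (parabPoint v (c * h) (d * h) (bits w)) =
          (a ^ 2 + a + b ^ 2 + b) / 2 * h ^ 2 -
            h ^ 2 / 2 * (((c : ℝ) - a) ^ 2 + (d - b) ^ 2 - (c - a) - (d - b)) := by
      intro c d w
      rw [innerSL_apply_apply, inner_parabPoint]
      simp [n, inner_add_left, real_inner_smul_left, inner_frame hv, hv.1]
      ring
    refine isExposed_convexHull_of_maximizers (finite_liftedLattice v h (finite_evenGrid N)) ?_ (innerSL ℝ n)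
      ((a ^ 2 + a + b ^ 2 + b) / 2 * h ^ 2) ?_ ?_
      ⟨_, parabPoint_mem_liftedLattice v h (D := {(a, b), (a + 1, b + 1)}) (Or.inl rfl)
        fun _ => false⟩
    · exact Set.image_mono (Set.prod_mono hsub le_rfl)
    · rintro _ ⟨⟨⟨c, d⟩, w⟩, ⟨hcd, -⟩, rfl⟩
      simp only
      rw [hval]
      have h1 := (abs_nonneg _).trans (real_abs_sub_le_of_even hab hcd.2)
      have := mul_nonneg (by positivity : 0 ≤ h ^ 2 / 2) h1
      linarith
    · rintro _ ⟨⟨⟨c, d⟩, w⟩, ⟨hcd, -⟩, rfl⟩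
      simp only
      rw [hval]
      constructor
      · intro he
        have h2 : 0 < h ^ 2 / 2 := by positivity
        have h3 : ((c : ℝ) - a) ^ 2 + (d - b) ^ 2 - (c - a) - (d - b) = 0 := by
          have : h ^ 2 / 2 * (((c : ℝ) - a) ^ 2 + (d - b) ^ 2 - (c - a) - (d - b)) = 0 := by
            linarith
          exact (mul_eq_zero.1 this).resolve_left h2.ne'
        refine parabPoint_mem_liftedLattice v h ?_ w
        rcases nat_eq_of_even hab hcd.2 h3.le with ⟨rfl, rfl⟩ | ⟨rfl, rfl⟩ <;> simp
      · rintro ⟨⟨q, w'⟩, ⟨hq, -⟩, he⟩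
        simp only at he
        rw [← hval c d w, ← he, hval]
        rcases hq with hq | hq
        · simp only at hq
          subst hq
          simp
        · simp only [Set.mem_singleton_iff] at hq
          subst hq
          push_cast
          ring
  · rw [vectorSpan_edgeFace hh, finrank_edgeSpace hv]

/-- The exterior angle at an edge face contains the directions lying between the normals of the
two adjacent facets. -/
theorem mem_exteriorAngle_edgeFace (hh : 0 < h) (hab : Even (a + b))
    (u : Metric.sphere (0 : (vectorSpan ℝ (edgeFace v h a b))ᗮ) 1)
    (hz : 0 < inner ℝ ((u : (vectorSpan ℝ (edgeFace v h a b))ᗮ) : V) (v (.inl 2)))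
    (hu : |inner ℝ ((u : (vectorSpan ℝ (edgeFace v h a b))ᗮ) : V) (v (.inl 0)) -
      inner ℝ ((u : (vectorSpan ℝ (edgeFace v h a b))ᗮ) : V) (v (.inl 1)) -
      (a - b) * h * inner ℝ ((u : (vectorSpan ℝ (edgeFace v h a b))ᗮ) : V) (v (.inl 2))| ≤
      h * inner ℝ ((u : (vectorSpan ℝ (edgeFace v h a b))ᗮ) : V) (v (.inl 2))) :
    u ∈ exteriorAngle (latticeBody v h (evenGrid N) (finite_evenGrid N) (nonempty_evenGrid N))
      (edgeFace v h a b) := by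
  obtain ⟨x₀, hx₀⟩ := (Set.Nonempty.intrinsicInterior (convex_convexHull ℝ _)
    ⟨_, parabPoint_mem_edgeFace (v := v) (h := h) (a := a) (b := b) fun _ => false⟩ :
      (intrinsicInterior ℝ (edgeFace v h a b)).Nonempty)
  refine ⟨x₀, hx₀, ?_⟩
  set U : V := ((u : (vectorSpan ℝ (edgeFace v h a b))ᗮ) : V)
  have horth : ∀ e ∈ vectorSpan ℝ (edgeFace v h a b), inner ℝ U e = 0 := fun e he =>
    Submodule.inner_left_of_mem_orthogonal he (u : (vectorSpan ℝ (edgeFace v h a b))ᗮ).2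
  set p₀ := parabPoint v (a * h) (b * h) (bits fun _ : Fin m => false)
  have hp₀ : inner ℝ U x₀ = inner ℝ U p₀ := by
    rw [← sub_eq_zero, ← inner_sub_right]
    exact horth _ (vsub_mem_vectorSpan ℝ (intrinsicInterior_subset hx₀)
      (parabPoint_mem_edgeFace _))
  rw [vectorSpan_edgeFace hh] at horth
  have hb : ∀ j, inner ℝ U (v (.inr j)) = 0 := fun j => horth _ (inr_mem_edgeSpace _ j)
  have he := horth _ (edgeVec_mem_edgeSpace _)
  simp only [edgeVec, inner_sub_right, inner_add_right, real_inner_smul_right] at he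
  set x := inner ℝ U (v (.inl 0))
  set y := inner ℝ U (v (.inl 1))
  set z := inner ℝ U (v (.inl 2))
  have hconv : Convex ℝ {p : V | inner ℝ U p ≤ inner ℝ U p₀} :=
    convex_halfSpace_le (innerₛₗ ℝ U).isLinear _
  intro p hp
  rw [inner_sub_right, hp₀, sub_nonpos]
  refine convexHull_min ?_ hconv hp
  rintro _ ⟨⟨⟨c, d⟩, w⟩, ⟨hcd, -⟩, rfl⟩
  simp only [Set.mem_ofPred_eq, p₀, inner_parabPoint, hb, mul_zero, Finset.sum_const_zero,
    add_zero]
  change c * h * x + d * h * y - ((c * h) ^ 2 + (d * h) ^ 2) / 2 * z ≤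
    a * h * x + b * h * y - ((a * h) ^ 2 + (b * h) ^ 2) / 2 * z
  -- Orthogonality to the edge fixes `x + y = (a + b + 1) h z`, so in the frame `U` is `z` times the
  -- midpoint normal tilted by `δ / 2` along `v₀ - v₁`. Since `|δ| ≤ h z`, the parity inequality
  -- absorbs the tilt.
  set δ := x - y - (a - b) * h * z with hδ
  have hx : x = (a + 1 / 2) * h * z + δ / 2 := by rw [hδ]; linarith
  have hy : y = (b + 1 / 2) * h * z - δ / 2 := by rw [hδ]; linarith
  have hpar := real_abs_sub_le_of_even hab hcd.2
  have hprod : δ * (((c : ℝ) - a) - (d - b)) ≤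
      h * z * (((c : ℝ) - a) ^ 2 + (d - b) ^ 2 - (c - a) - (d - b)) := by
    refine (le_abs_self _).trans ?_
    rw [abs_mul]
    exact mul_le_mul hu hpar (abs_nonneg _) (by positivity)
  rw [hx, hy]
  nlinarith [mul_le_mul_of_nonneg_left hprod hh.le]

end EdgeFaces

end

noncomputable section

/-! ### Exterior angles of a row of parallel edges cover a fixed cone -/

section EdgeNormals

variable {V : Type*} [NormedAddCommGroup V] [InnerProductSpace ℝ V] {m : ℕ}
  {v : Fin 3 ⊕ Fin m → V}

/-- The directions lying between the normals of the two facets at an edge of the even grid. -/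
def edgeNormals (v : Fin 3 ⊕ Fin m → V) (h : ℝ) (a b : ℕ) : Set V :=
  {x | 0 < (inner ℝ x (v (.inl 2)) : ℝ) ∧
    |(inner ℝ x (v (.inl 0)) : ℝ) - inner ℝ x (v (.inl 1)) - (a - b) * h * inner ℝ x (v (.inl 2))| ≤
      h * (inner ℝ x (v (.inl 2)) : ℝ)}

theorem exists_edgeNormals {M : ℕ} (hM : 1 ≤ M) (i : ℕ) {x : V}
    (hz : 0 < (inner ℝ x (v (.inl 2)) : ℝ))
    (hx : |(inner ℝ x (v (.inl 0)) : ℝ) - inner ℝ x (v (.inl 1))| ≤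
      (inner ℝ x (v (.inl 2)) : ℝ) / 2) :
    ∃ j ∈ Finset.range (2 * M + 1),
      x ∈ edgeNormals v ((4 * M : ℕ) : ℝ)⁻¹ (i + j) (i + (2 * M - j)) := by
  have hM0 : (0 : ℝ) < M := by exact_mod_cast hM
  set z : ℝ := inner ℝ x (v (.inl 2))
  set d : ℝ := (inner ℝ x (v (.inl 0)) : ℝ) - inner ℝ x (v (.inl 1))
  obtain ⟨hd1, hd2⟩ := abs_le.1 hx
  set s : ℝ := 2 * M * d / z + M with hs
  have hd : d = (s - M) * z / (2 * M) := by rw [hs]; field_simp; ring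
  have hs0 : 0 ≤ s := by
    have : -(M : ℝ) ≤ 2 * M * d / z := by rw [le_div_iff₀ hz]; nlinarith
    linarith
  have hs1 : s ≤ 2 * M := by
    have : 2 * M * d / z ≤ (M : ℝ) := by rw [div_le_iff₀ hz]; nlinarith
    linarith
  have hj1 := Nat.floor_le (a := s + 1 / 2) (by linarith)
  have hj2 := Nat.lt_floor_add_one (s + 1 / 2)
  set j := ⌊s + 1 / 2⌋₊
  have hj : j ≤ 2 * M := by
    have : (j : ℝ) < (2 * M + 1 : ℕ) := by push_cast; linarith
    have : j < 2 * M + 1 := by exact_mod_cast this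
    omega
  refine ⟨j, Finset.mem_range.2 (by omega), hz, ?_⟩
  push_cast [Nat.cast_sub hj]
  change |d - _ * _ * z| ≤ _ * z
  have : d - ((i : ℝ) + j - (i + (2 * M - j))) * (4 * (M : ℝ))⁻¹ * z =
      (2 * (s - j)) * ((4 * (M : ℝ))⁻¹ * z) := by
    rw [hd]; field_simp; ring
  rw [this, abs_mul, abs_of_pos (by positivity : 0 < (4 * (M : ℝ))⁻¹ * z)]
  refine mul_le_of_le_one_left (by positivity) (abs_le.2 ⟨by linarith, by linarith⟩)

end EdgeNormals

/-! ### The uniform lower bound over the even grid -/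

section LowerBound

variable {V : Type*} [NormedAddCommGroup V] [InnerProductSpace ℝ V] [FiniteDimensional ℝ V]
  [MeasurableSpace V] [BorelSpace V] {m : ℕ} {v : Fin 3 ⊕ Fin m → V} {h : ℝ}

theorem le_phiTerm_edgeFace (hv : Orthonormal ℝ v) (hh : 0 < h) {a b N : ℕ} {μ : ℝ}
    (hμ : (a + b + 1) * h = μ) (hμ1 : μ ≤ 1) (hab : Even (a + b)) :
    h * ((sphereProb (edgeSpace v μ)ᗮ).real
        {u | ((u : (edgeSpace v μ)ᗮ) : V) ∈ edgeNormals v h a b} * (1 / 9)) ≤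
      phiTerm v (latticeBody v h (evenGrid N) (finite_evenGrid N) (nonempty_evenGrid N))
        (edgeFace v h a b) := by
  have hμ0 : 0 ≤ μ := by rw [← hμ]; positivity
  have hg := entryPoly_edgeSpace hv μ (by nlinarith)
  subst hμ
  rw [← vectorSpan_edgeFace hh] at hg ⊢
  unfold phiTerm
  gcongr
  · exact measureReal_nonneg
  · exact le_faceVolume_edgeFace hv hh
  · exact measure_ne_top _ _
  · exact fun u hu => mem_exteriorAngle_edgeFace hh hab u hu.1 hu.2

/-- The value of the functional on the even grid polytopes is bounded below. -/
theorem le_re_phi_evenGrid (hv : Orthonormal ℝ v) {M : ℕ} (hM : 1 ≤ M) :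
    (1 / 36 : ℝ) * (1 / 10) ^ (Module.finrank ℝ V - (m + 1)) ≤
      (phi (OrthFlag.flagFun (m + 1) v) (latticeBody v ((4 * M : ℕ) : ℝ)⁻¹ (evenGrid (4 * M))
        (finite_evenGrid _) (nonempty_evenGrid _))).re := by
  have hM0 : (0 : ℝ) < M := by exact_mod_cast hM
  set h : ℝ := ((4 * M : ℕ) : ℝ)⁻¹ with hh_def
  have hh : 0 < h := by rw [hh_def]; push_cast; positivity
  have hMh : 4 * M * h = 1 := by rw [hh_def]; push_cast; field_simp
  set P := latticeBody v h (evenGrid (4 * M)) (finite_evenGrid _) (nonempty_evenGrid _)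
  have heven : ∀ i j : ℕ, j ≤ 2 * M → Even (i + j + (i + (2 * M - j))) := fun i j hj =>
    ⟨i + M, by omega⟩
  -- In row `i` all edges have `a + b = 2i + 2M`, hence the same slope `μ` and a common orthogonal
  -- complement in which their angles can be added.
  have hrow : ∀ i ∈ Finset.range M, h * ((1 / 10) ^ (Module.finrank ℝ V - (m + 1)) * (1 / 9)) ≤
      ∑ j ∈ Finset.range (2 * M + 1), phiTerm v P (edgeFace v h (i + j) (i + (2 * M - j))) := by
    intro i hi
    have hi' : (i : ℝ) + 1 ≤ M := by exact_mod_cast Finset.mem_range.1 hi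
    set μ : ℝ := (2 * i + 2 * M + 1) * h with hμ
    have hμ0 : 0 ≤ μ := by positivity
    have hμ1 : μ ≤ 1 := by rw [hμ, ← hMh]; gcongr; linarith
    have hdim : Module.finrank ℝ (edgeSpace v μ)ᗮ = Module.finrank ℝ V - (m + 1) := by
      have := (edgeSpace v μ).finrank_add_finrank_orthogonal
      rw [finrank_edgeSpace hv] at this
      omega
    have hterm : ∀ j ∈ Finset.range (2 * M + 1), h * ((sphereProb (edgeSpace v μ)ᗮ).real
        {u | ((u : (edgeSpace v μ)ᗮ) : V) ∈ edgeNormals v h (i + j) (i + (2 * M - j))} *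
          (1 / 9)) ≤ phiTerm v P (edgeFace v h (i + j) (i + (2 * M - j))) := by
      intro j hj
      have hj : j ≤ 2 * M := by have := Finset.mem_range.1 hj; omega
      refine le_phiTerm_edgeFace hv hh ?_ hμ1 (heven i j hj)
      push_cast [Nat.cast_sub hj]
      rw [hμ]; ring
    refine le_trans ?_ (Finset.sum_le_sum hterm)
    rw [← Finset.mul_sum, ← Finset.sum_mul, ← hdim]
    gcongr
    -- The fixed cone is covered by the edge normals of the row, so subadditivity bounds the sum of
    -- the angles from below.
    refine (pow_le_sphereProb_edgeSpace hv μ hμ0 hμ1).trans (le_trans (measureReal_mono ?_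
      (measure_ne_top _ _))
      (measureReal_biUnion_finset_le _ _))
    intro u hu
    obtain ⟨j, hj, hju⟩ := exists_edgeNormals hM i hu.1 hu.2
    exact Set.mem_biUnion hj hju
  have hsum := sum_phiTerm_le_re_phi (k := m + 1) v
    (isPolytope_latticeBody v h (finite_evenGrid (4 * M)) (nonempty_evenGrid _))
    (Finset.range M ×ˢ Finset.range (2 * M + 1))
    (fun q => edgeFace v h (q.1 + q.2) (q.1 + (2 * M - q.2))) ?_ ?_
  · refine le_trans ?_ hsum
    rw [Finset.sum_product]
    refine le_trans ?_ (Finset.sum_le_sum hrow)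
    rw [Finset.sum_const, Finset.card_range, nsmul_eq_mul]
    -- There are `M` rows and `M h = 1/4`, whence `1/36 = 1/4 · 1/9`.
    have : (M : ℝ) * (h * ((1 / 10) ^ (Module.finrank ℝ V - (m + 1)) * (1 / 9))) =
        (4 * M * h) * (1 / 36 * (1 / 10) ^ (Module.finrank ℝ V - (m + 1))) := by ring
    rw [this, hMh, one_mul]
  · rintro ⟨i, j⟩ hij
    simp only [Finset.mem_product, Finset.mem_range] at hij
    exact edgeFace_mem_kFaces hv hh (heven i j (by omega)) (by simp only; omega)
      (by simp only; omega)
  · rintro ⟨i, j⟩ hij ⟨i', j'⟩ hij' heq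
    simp only [Finset.coe_product, Finset.coe_range, Set.mem_prod, Set.mem_Iio] at hij hij'
    have := edgeFace_injective hv hh heq
    simp only at this
    ext <;> simp only <;> omega

end LowerBound

/-! ### Two different limits at the same convex body -/

section Discontinuity

variable {V : Type*} [NormedAddCommGroup V] [InnerProductSpace ℝ V] [FiniteDimensional ℝ V]
  {m : ℕ} {v : Fin 3 ⊕ Fin m → V}

theorem tendsto_latticeBody (hv : Orthonormal ℝ v) (D : ℕ → Set (ℕ × ℕ))
    (hfin : ∀ N, (D N).Finite) (hne : ∀ N, (D N).Nonempty) (hsub : ∀ N, D N ⊆ squareGrid N)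
    (hsup : ∀ N, evenGrid N ⊆ D N) :
    Filter.Tendsto (fun M : ℕ => latticeBody v ((4 * (M + 1) : ℕ) : ℝ)⁻¹ (D (4 * (M + 1)))
      (hfin _) (hne _)) Filter.atTop (𝓝 (parabBody v)) := by
  rw [tendsto_iff_dist_tendsto_zero]
  have hlim : Filter.Tendsto (fun M : ℕ => 2 * (1 / ((M : ℝ) + 1))) Filter.atTop (𝓝 0) := by
    simpa using tendsto_one_div_add_atTop_nhds_zero_nat.const_mul (2 : ℝ)
  refine squeeze_zero (fun _ => dist_nonneg) (fun M => ?_) hlim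
  refine (dist_latticeBody_parabBody_le hv (by positivity) (hfin _) (hne _)
    (fun q hq => ?_) fun x hx y hy => ?_).trans (le_of_eq ?_)
  · exact ⟨cast_mul_inv_le_one (hsub _ hq).1, cast_mul_inv_le_one (hsub _ hq).2⟩
  · obtain ⟨q, hq, h⟩ := exists_evenGrid_near (N := 4 * (M + 1)) (by omega) hx hy
    exact ⟨q, hsup _ hq, h⟩
  · push_cast
    field_simp
    norm_num

variable [MeasurableSpace V] [BorelSpace V]

theorem not_phiExtends_flagFun (hv : Orthonormal ℝ v) :
    ¬ PhiExtends (OrthFlag.flagFun (m + 1) v) := by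
  rintro ⟨Φ, hΦ, hext⟩
  have hsq := (hΦ.tendsto _).comp (tendsto_latticeBody hv squareGrid finite_squareGrid
    nonempty_squareGrid (fun _ => le_rfl) fun _ _ hq => hq.1)
  have hev := (hΦ.tendsto _).comp (tendsto_latticeBody hv evenGrid finite_evenGrid
    nonempty_evenGrid (fun _ _ hq => hq.1) fun _ => le_rfl)
  have hzero : Φ (parabBody v) = 0 := by
    refine tendsto_nhds_unique hsq (tendsto_const_nhds.congr fun M => ?_)
    rw [Function.comp_apply, hext _ (isPolytope_latticeBody _ _ _ _)]
    exact (phi_flagFun_eq_zero v _ fun F hF => entryPoly_eq_zero_of_mem_kFaces hv _ _ _ hF).symm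
  have hle : (1 / 36 : ℝ) * (1 / 10) ^ (Module.finrank ℝ V - (m + 1)) ≤ (Φ (parabBody v)).re := by
    refine ge_of_tendsto' ((Complex.continuous_re.tendsto _).comp hev) fun M => ?_
    rw [Function.comp_apply, Function.comp_apply, hext _ (isPolytope_latticeBody _ _ _ _)]
    exact le_re_phi_evenGrid hv (Nat.le_add_left 1 M)
  rw [hzero, Complex.zero_re] at hle
  exact absurd hle (not_le.2 (by positivity))

end Discontinuity

end

theorem theorem0p4 {V : Type*} [NormedAddCommGroup V] [InnerProductSpace ℝ V]
    [FiniteDimensional ℝ V] [MeasurableSpace V] [BorelSpace V]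
    (n k : ℕ) (hdim : Module.finrank ℝ V = n) (hn : 3 ≤ n) (hk : 1 ≤ k) (hkn : k ≤ n - 2) :
    ∃ f : OrthFlag V k → ℂ,
      OrthFlag.IsRealAnalytic f ∧ OrthFlag.IsOrthogonallyFinite f ∧ ¬ PhiExtends f := by
  obtain ⟨m, rfl⟩ : ∃ m, k = m + 1 := ⟨k - 1, by omega⟩
  let e : Fin 3 ⊕ Fin m ↪ Fin (Module.finrank ℝ V) :=
    finSumFinEquiv.toEmbedding.trans (Fin.castLEEmb (by omega))
  have hv : Orthonormal ℝ (stdOrthonormalBasis ℝ V ∘ e) :=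
    (stdOrthonormalBasis ℝ V).orthonormal.comp e e.injective
  exact ⟨OrthFlag.flagFun (m + 1) (stdOrthonormalBasis ℝ V ∘ e), OrthFlag.isRealAnalytic_flagFun _,
    OrthFlag.isOrthogonallyFinite_of_mem_pow (OrthFlag.flagFun_mem_pow _),
    not_phiExtends_flagFun hv⟩
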